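/- **Setting.** Let $\mathrm{AP}$ be a finite set of atomic propositions and $\mathcal V$ a set of trace variables. A *trace* is an element of $([0,1]^{\mathrm{AP}})^\omega$; $t[k]$ is its $k$-th letter and $t[i,\infty]$ its suffix from position $i$. A *weighted Kripke structure* $\mathcal K=\langle S,\mathbb W,I,\to,L\rangle$ consists of a finite set $S$ of states, a finite set $\mathbb W\subset[0,1]$ of weights, a set $I\subseteq S$ of initial states, a total relation ${\to}\subseteq S\times S$ and a labelling $L\colon S\to\mathbb W^{\mathrm{AP}}$. Its set of traces $\mathbb T(\mathcal K)$ consists of all $L(s_0)L(s_1)\cdots$ with $s_0\in I$ and $s_i\to s_{i+1}$ for all $i$; it is assumed to be non-empty. Put $|\mathcal K|=|S|+|\mathbb W|+|\mathrm{AP}|$. Let $\mathcal F$ be a family of function symbols, each $f\in\mathcal F$ of some arity $k$ being interpreted as an arbitrary function $f\colon[0,1]^k\to[0,1]$. The formulas $\psi$ of $\mathrm{HyperLTL}_{\mathrm{prop}}$ are given by $$\psi ::= \forall\pi\,\psi\mid\exists\pi\,\psi\mid\varphi\qquad \varphi::=\mathrm{true}\mid\mathrm{false}\mid p_\pi\mid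 f(\varphi,\dots,\varphi)\mid \mathsf X\varphi\mid\varphi\,\mathsf U\,\varphi$$ with $p\in\mathrm{AP}$, $\pi\in\mathcal V$, $f\in\mathcal F$. For a trace assignment $\Pi$ and a set $T$ of traces, the value $[\![\psi]\!]^T_\Pi\in[0,1]$ is defined by: $\mathrm{true}$ has value $1$, $\mathrm{false}$ has value $0$, $p_\pi$ has value $\Pi(\pi)[0](p)$, $f(\varphi_1,\dots,\varphi_k)$ has value $f$ applied to the values of the $\varphi_i$, $[\![\mathsf X\varphi]\!]_\Pi^T=[\![\varphi]\!]^T_{\Pi[1,\infty]}$, $$[\![\varphi_1\mathsf U\varphi_2]\!]^T_\Pi=\sup_{i\ge0}\min\Big([\![\varphi_2]\!]^T_{\Pi[i,\infty]},\min_{0\le j<i}[\![\varphi_1]\!]^T_{\Pi[j,\infty]}\Big)$$ (a minimum over no index being $1$), and $[\![\forall\pi\,\psi]\!]^T_\Pi=\inf_{t\in T}[\![\psi]\!]^T_{\Pi[\pi\mapsto t]}$, $[\![\exists\pi\,\psi]\!]^T_\Pi=\sup_{t\in T}[\![\psi]\!]^T_{\Pi[\pi\mapsto t]}$. Let $|\psi|$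 be the number of nodes of the syntax tree of $\psi$, $\mathrm{alt}(\psi)$ the number of quantifier alternations in its prefix, and $X$ the finite set of its free variables. For an assignment $\Pi\colon X\to\mathbb T(\mathcal K)$ let $t_\Pi$ be the infinite word over the alphabet $\mathbb W^{X\times\mathrm{AP}}$ with $t_\Pi[k](\pi,p)=\Pi(\pi)[k](p)$ for all $k\in\mathbb N$, $\pi\in X$, $p\in\mathrm{AP}$. The size of a nondeterministic Büchi automaton (NBA) is its number of states plus its number of transitions. Let $\mathrm{tow}(0,n)=n$ and $\mathrm{tow}(h+1,n)=2^{\mathrm{tow}(h,n)}$. **Proposition.** There are universal constants $a,b\in\mathbb N$ such that for all $\mathcal F$, $\mathrm{AP}$, $\mathcal V$, every $\mathrm{HyperLTL}_{\mathrm{prop}}$ formula $\psi$, every $P\subseteq[0,1]$ and every Kripke structure $\mathcal K$ with $\mathbb T(\mathcal K)\neq\emptyset$ there is an NBA $\mathcal A^P_{\mathcal K,\psi}$ over the alphabet $\mathbb W^{X\times\mathrm{AP}}$ with $$\mathcal L(\mathcal A^P_{\mathcal K,\psi})=\big\{\,t_\Pi \;\big|\; \Pi\colon X\to\mathbb T(\mathcal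 K),\ [\![\psi]\!]^{\mathbb T(\mathcal K)}_\Pi\in P\,\big\}$$ and of size at most $\mathrm{tow}\big(a\cdot\mathrm{alt}(\psi)+b,\ |\psi|+|\mathcal K|\big)$. -/

import Mathlib

universe u v w x

open unitInterval

namespace HyperLTLProp



/-! ### Traces and Kripke structures -/

/-- A trace over `AP`: an infinite sequence of weightings of the atomic propositions in `[0,1]`. -/
abbrev Trace (AP : Type u) : Type u := ℕ → AP → I

/-- The suffix `t[i,∞]` of a trace. -/
def Trace.suffix {AP : Type u} (t : Trace AP) (i : ℕ) : Trace AP := fun k => t (i + k)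

/-- A weighted Kripke structure `⟨S, W, I, →, L⟩` over the atomic propositions `AP`. -/
structure Kripke (AP : Type u) where
  State : Type v
  [finiteState : Finite State]
  /-- the finite set of weights -/
  weights : Finset I
  /-- the initial states -/
  init : Set State
  /-- the transition relation -/
  trans : State → State → Prop
  /-- the transition relation is total: there are no deadlocks -/
  total : ∀ s, ∃ s', trans s s'
  label : State → AP → weights

namespace Kripke

variable {AP : Type u}

/-- A path: an infinite sequence of states that starts in an initial state and follows `→`. -/
def IsPath (K : Kripke.{u, v} AP) (s : ℕ → K.State) : Prop :=
  s 0 ∈ K.init ∧ ∀ i, K.trans (s i) (s (i + 1))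

/-- The set of traces of a Kripke structure. -/
def traces (K : Kripke.{u, v} AP) : Set (Trace AP) :=
  {t | ∃ s : ℕ → K.State, K.IsPath s ∧ ∀ k p, t k p = (K.label (s k) p : I)}

/-- Every value occurring in a trace of `K` is one of the weights of `K`. -/
theorem mem_weights_of_mem_traces (K : Kripke.{u, v} AP) {t : Trace AP} (ht : t ∈ K.traces)
    (k : ℕ) (p : AP) : t k p ∈ K.weights := by
  obtain ⟨s, -, hs⟩ := ht
  rw [hs k p]
  exact (K.label (s k) p).2

/-- The size of a Kripke structure: number of states, of weights and of atomic propositions.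
(The number of transitions is at most the square of the number of states.) -/
noncomputable def size (K : Kripke.{u, v} AP) : ℕ :=
  Nat.card K.State + K.weights.card + Nat.card AP

end Kripke

/-! ### Nondeterministic Büchi automata -/

/-- A nondeterministic Büchi automaton over the finite alphabet `α`. -/
structure NBA (α : Type u) [Finite α] where
  State : Type
  [finiteState : Finite State]
  init : Set State
  step : State → α → Set State
  accept : Set State

namespace NBA

variable {α : Type u} [Finite α]

/-- `r` is a run of the automaton on the word `w`. -/
def IsRun (A : NBA α) (w : ℕ → α) (r : ℕ → A.State) : Prop :=
  r 0 ∈ A.init ∧ ∀ i, r (i + 1) ∈ A.step (r i) (w i)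

/-- The set of states that occur infinitely often in a sequence of states. -/
def infStates (A : NBA α) (r : ℕ → A.State) : Set A.State :=
  {q | {i | r i = q}.Infinite}

/-- The accepted language: the words having a run that visits `accept` infinitely often. -/
def language (A : NBA α) : Set (ℕ → α) :=
  {w | ∃ r, A.IsRun w r ∧ (A.infStates r ∩ A.accept).Nonempty}

/-- The size of an automaton: number of states plus number of transitions `(q, a, q')`. -/
noncomputable def size (A : NBA α) : ℕ :=
  Nat.card A.State + Nat.card {e : A.State × α × A.State // e.2.2 ∈ A.step e.1 e.2.1}

end NBA

/-! ### Syntax -/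

/-- A family of function symbols, each one with an arity `k` and interpreted as an arbitrary
function `[0,1]^k → [0,1]`. -/
structure Functions where
  Symbol : Type w
  arity : Symbol → ℕ
  interp : (f : Symbol) → (Fin (arity f) → I) → I

/-- Quantifier-free formulas, with atomic propositions `p_π` for `p : AP` and `π : V`. -/
inductive QFFormula (F : Functions.{w}) (AP : Type u) (V : Type x) : Type (max u w x)
  | tt : QFFormula F AP V
  | ff : QFFormula F AP V
  | atom (p : AP) (π : V) : QFFormula F AP V
  | app (f : F.Symbol) (φ : Fin (F.arity f) → QFFormula F AP V) : QFFormula F AP V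
  | next (φ : QFFormula F AP V) : QFFormula F AP V
  | untl (φ₁ φ₂ : QFFormula F AP V) : QFFormula F AP V

/-- HyperLTL formulas with propositional quality: a prefix of trace quantifiers followed by a
quantifier-free formula. -/
inductive Formula (F : Functions.{w}) (AP : Type u) (V : Type x) : Type (max u w x)
  | all (π : V) (ψ : Formula F AP V) : Formula F AP V
  | ex (π : V) (ψ : Formula F AP V) : Formula F AP V
  | qf (φ : QFFormula F AP V) : Formula F AP V

variable {F : Functions.{w}} {AP : Type u} {V : Type x}

/-- The number of nodes of the syntax tree. -/
def QFFormula.size : QFFormula F AP V → ℕ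
  | .tt => 1
  | .ff => 1
  | .atom _ _ => 1
  | .app _ φ => 1 + ∑ i, (φ i).size
  | .next φ => 1 + φ.size
  | .untl φ₁ φ₂ => 1 + φ₁.size + φ₂.size

/-- The number of nodes of the syntax tree. -/
def Formula.size : Formula F AP V → ℕ
  | .all _ ψ => 1 + ψ.size
  | .ex _ ψ => 1 + ψ.size
  | .qf φ => φ.size

/-- The trace variables occurring in a quantifier-free formula. -/
def QFFormula.freeVars [DecidableEq V] : QFFormula F AP V → Finset V
  | .tt => ∅
  | .ff => ∅
  | .atom _ π => {π}
  | .app _ φ => Finset.univ.biUnion fun i => (φ i).freeVars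
  | .next φ => φ.freeVars
  | .untl φ₁ φ₂ => φ₁.freeVars ∪ φ₂.freeVars

/-- The free trace variables of a formula. -/
def Formula.freeVars [DecidableEq V] : Formula F AP V → Finset V
  | .all π ψ => ψ.freeVars.erase π
  | .ex π ψ => ψ.freeVars.erase π
  | .qf φ => φ.freeVars

/-- The number of quantifier alternations: the number of positions in the quantifier prefix where
`∀` is immediately followed by `∃`, or `∃` by `∀`. -/
def Formula.alternations : Formula F AP V → ℕ
  | .all _ (.ex π ψ) => 1 + (Formula.ex π ψ).alternations
  | .ex _ (.all π ψ) => 1 + (Formula.all π ψ).alternations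
  | .all _ ψ => ψ.alternations
  | .ex _ ψ => ψ.alternations
  | .qf _ => 0

/-! ### Semantics -/

/-- The satisfaction value of a quantifier-free formula under a trace assignment. The infimum over
the empty set of indices `j < 0` is `1`, the greatest element of `[0,1]`. -/
noncomputable def QFFormula.value : QFFormula F AP V → (V → Trace AP) → I
  | .tt, _ => 1
  | .ff, _ => 0
  | .atom p π, ρ => ρ π 0 p
  | .app f φ, ρ => F.interp f fun i => (φ i).value ρ
  | .next φ, ρ => φ.value fun π => (ρ π).suffix 1
  | .untl φ₁ φ₂, ρ =>
      ⨆ i : ℕ, φ₂.value (fun π => (ρ π).suffix i) ⊓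
        ⨅ j : ℕ, ⨅ _ : j < i, φ₁.value fun π => (ρ π).suffix j

/-- The satisfaction value of a formula under the trace assignment `ρ`, the quantified variables
ranging over the set of traces `T`. -/
noncomputable def Formula.value [DecidableEq V] (T : Set (Trace AP)) :
    Formula F AP V → (V → Trace AP) → I
  | .all π ψ, ρ => ⨅ t : T, ψ.value T (Function.update ρ π t.1)
  | .ex π ψ, ρ => ⨆ t : T, ψ.value T (Function.update ρ π t.1)
  | .qf φ, ρ => φ.value ρ

/-- An assignment of the variables in `X` seen as a total assignment. The variables outside `X` get
a dummy trace, which is irrelevant for formulas whose free variables lie in `X`. -/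
def extendAssignment [DecidableEq V] {X : Finset V} (ρ : X → Trace AP) : V → Trace AP :=
  fun π => if h : π ∈ X then ρ ⟨π, h⟩ else fun _ _ => 0

theorem QFFormula.value_congr [DecidableEq V] (φ : QFFormula F AP V) :
    ∀ {ρ ρ' : V → Trace AP}, (∀ π ∈ φ.freeVars, ρ π = ρ' π) → φ.value ρ = φ.value ρ' := by
  induction φ with
  | tt => intros; rfl
  | ff => intros; rfl
  | atom p π => intro ρ ρ' h; simp [value, h π (by simp [freeVars])]
  | app f φ ih =>
    intro ρ ρ' h
    simp only [value]
    congr 1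
    funext i
    exact ih i fun π hπ => h π (by
      simp only [freeVars, Finset.mem_biUnion, Finset.mem_univ, true_and]; exact ⟨i, hπ⟩)
  | next φ ih =>
    intro ρ ρ' h
    simp only [value]
    exact ih fun π hπ => by rw [h π hπ]
  | untl φ₁ φ₂ ih₁ ih₂ =>
    intro ρ ρ' h
    have h₁ : ∀ j, φ₁.value (fun π => (ρ π).suffix j) = φ₁.value (fun π => (ρ' π).suffix j) :=
      fun j => ih₁ fun π hπ => by rw [h π (by simp [freeVars, hπ])]
    have h₂ : ∀ j, φ₂.value (fun π => (ρ π).suffix j) = φ₂.value (fun π => (ρ' π).suffix j) :=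
      fun j => ih₂ fun π hπ => by rw [h π (by simp [freeVars, hπ])]
    simp only [value, h₁, h₂]

/-- The value of a formula depends only on the traces assigned to its free variables. -/
theorem Formula.value_congr [DecidableEq V] (T : Set (Trace AP)) (ψ : Formula F AP V) :
    ∀ {ρ ρ' : V → Trace AP}, (∀ π ∈ ψ.freeVars, ρ π = ρ' π) → ψ.value T ρ = ψ.value T ρ' := by
  induction ψ with
  | all π ψ ih =>
    intro ρ ρ' h
    simp only [value]
    refine iInf_congr fun t => ih fun π' hπ' => ?_
    by_cases hp : π' = π
    · subst hp; simp
    · simp [Function.update_of_ne hp, h π' (by simp [freeVars, hp, hπ'])]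
  | ex π ψ ih =>
    intro ρ ρ' h
    simp only [value]
    refine iSup_congr fun t => ih fun π' hπ' => ?_
    by_cases hp : π' = π
    · subst hp; simp
    · simp [Function.update_of_ne hp, h π' (by simp [freeVars, hp, hπ'])]
  | qf φ => intro ρ ρ' h; exact φ.value_congr h

/-! ### Encoding of assignments, and the tower function -/

/-- The letters `W^{AP_X}`, where `AP_X` is the set of the atomic propositions `p_π` for `p : AP`
and a variable `π` in `X`. -/
abbrev Letter (K : Kripke.{u, v} AP) (X : Finset V) : Type (max u x) := X × AP → K.weights

/-- The word `t_ρ` encoding an assignment `ρ` of the variables in `X` to traces of `K`: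
`t_ρ[k](p_π) = ρ(π)[k](p)`. -/
def encode (K : Kripke.{u, v} AP) {X : Finset V} (ρ : X → K.traces) : ℕ → Letter K X :=
  fun k pπ => ⟨(ρ pπ.1).1 k pπ.2, K.mem_weights_of_mem_traces (ρ pπ.1).2 k pπ.2⟩

/-- The tower of exponentials of height `h` with top exponent `n`. -/
def tower : ℕ → ℕ → ℕ
  | 0, n => n
  | h + 1, n => 2 ^ tower h n

end HyperLTLProp

/-!
The values of formulas on tuples of traces are treated by an algebraic notion of recognition. A
deterministic finite automaton *recognizes* a function `g` on infinite words if `g` agrees on any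
two words that have factorizations into blocks such that the automaton, restarted on each block,
reaches the same state on corresponding blocks (`Recognizes`). This notion has the following
features.

* It makes sense for functions with values in any set, and it is trivially closed under
  postcomposition, in particular under complements of languages, and under products.
* It is closed under projection, by the subset construction (`Recognizable.image`): on two words
  with matching blocks even the sets of the values of `g` on all words related to them letter by
  letter are equal. Hence a whole block of universal or of existential quantifiers costs a
  single exponential (`Recognizable.image_reassignments`), and no complementation of Büchi
  automata is needed.
* By the infinite Ramsey theorem every word has a factorization in which all blocks but the first
  lead to the same state. So a recognizable language is determined by pairs of states, and a
  Büchi automaton of polynomial size can guess such a factorization (`Recognizable.exists_nba`).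

It remains to recognize the value of a quantifier-free formula `φ` with a bounded number of
exponentials, independently of the nesting depth of `φ`. The values of all subformulas on a word are
determined by its first letter and their values on the remaining suffix, so every finite word acts
as a transformer of tuples of values, and the automaton computes this transformer. That the
transformers of the blocks determine the value (`BackwardEvaluator`) is shown by induction on
`φ`, the only interesting case being that of `U`, whose value is the supremum of the contributions
of the finite prefixes (`BackwardEvaluator.untl`).

The alphabet during the induction on the quantifier prefix consists of the valuations of `p_π` for
all variables `π`, bound or free. It may be infinite, since recognition only concerns the set of
states. The restriction to the free variables takes place in the last step.
-/

namespace HyperLTLProp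

/-! ### Recognition of functions on infinite words by finite automata -/

section Recognition

variable {Γ : Type*} {Δ : Type*} {Q : Type*} {α : Type*} {β : Type*}

/-- The suffix of an infinite word from position `i` on. -/
def dropWord (u : ℕ → Γ) (i : ℕ) : ℕ → Γ := fun k => u (i + k)

@[simp] theorem dropWord_zero (u : ℕ → Γ) : dropWord u 0 = u := by
  funext k; simp [dropWord]

theorem dropWord_dropWord (u : ℕ → Γ) (i j : ℕ) :
    dropWord (dropWord u i) j = dropWord u (i + j) := by
  funext k; simp [dropWord, add_assoc]

/-- The state reached by a deterministic automaton from `q` after the first `n` letters of `u`. -/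
def stateAfter (δ : Q → Γ → Q) (q : Q) (u : ℕ → Γ) : ℕ → Q
  | 0 => q
  | n + 1 => δ (stateAfter δ q u n) (u n)

theorem stateAfter_congr (δ : Q → Γ → Q) (q : Q) {u u' : ℕ → Γ} {n : ℕ}
    (h : ∀ m < n, u m = u' m) : stateAfter δ q u n = stateAfter δ q u' n := by
  induction n with
  | zero => rfl
  | succ n ih =>
    simp only [stateAfter]
    rw [ih fun m hm => h m (by omega), h n (by omega)]

/-- The cut positions of a factorization of an infinite word into finite non-empty blocks, the
`i`-th one being the block of the positions `k i, …, k (i + 1) - 1`. -/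
structure IsCutting (k : ℕ → ℕ) : Prop where
  strictMono : StrictMono k
  zero : k 0 = 0

/-- The state that a deterministic automaton started in `q` reaches on the `i`-th block of a word
cut at the positions `k`. -/
def blockState (δ : Q → Γ → Q) (q : Q) (u : ℕ → Γ) (k : ℕ → ℕ) (i : ℕ) : Q :=
  stateAfter δ q (dropWord u (k i)) (k (i + 1) - k i)

/-- A deterministic automaton recognizes a function on infinite words if the function takes the
same value on any two words that have factorizations into non-empty blocks on which the
automaton, restarted for each block, reaches the same states. -/
def Recognizes (δ : Q → Γ → Q) (q : Q) (g : (ℕ → Γ) → α) : Prop :=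
  ∀ ⦃u u' : ℕ → Γ⦄ ⦃k k' : ℕ → ℕ⦄, IsCutting k → IsCutting k' →
    (∀ i, blockState δ q u k i = blockState δ q u' k' i) → g u = g u'

/-- A function on infinite words is recognizable with `n` states if some deterministic automaton
with at most `n` states recognizes it. -/
def Recognizable (n : ℕ) (g : (ℕ → Γ) → α) : Prop :=
  ∃ (Q : Type) (_ : Finite Q) (δ : Q → Γ → Q) (q : Q), Nat.card Q ≤ n ∧ Recognizes δ q g

theorem IsCutting.lt {k : ℕ → ℕ} (hk : IsCutting k) (i : ℕ) : k i < k (i + 1) :=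
  hk.strictMono i.lt_succ_self

theorem IsCutting.exists_length {k : ℕ → ℕ} (hk : IsCutting k) :
    ∃ m, k (0 + 1) - k 0 = m + 1 :=
  ⟨k (0 + 1) - k 0 - 1, by have := hk.lt 0; omega⟩

theorem IsCutting.exists_block {k : ℕ → ℕ} (hk : IsCutting k) (n : ℕ) :
    ∃ i m, n = k i + m ∧ k i + m < k (i + 1) := by
  induction n with
  | zero => exact ⟨0, 0, by simp [hk.zero], by simpa using hk.lt 0⟩
  | succ n ih =>
    obtain ⟨i, m, rfl, h⟩ := ih
    by_cases h' : k i + m + 1 < k (i + 1)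
    · exact ⟨i, m + 1, by omega, by omega⟩
    · exact ⟨i + 1, 0, by omega, by simpa using hk.lt (i + 1)⟩

theorem IsCutting.block_unique {k : ℕ → ℕ} (hk : IsCutting k) {n i j : ℕ}
    (hi : k i ≤ n) (hi' : n < k (i + 1)) (hj : k j ≤ n) (hj' : n < k (j + 1)) : i = j := by
  have h₁ : i < j + 1 := hk.strictMono.lt_iff_lt.1 (by omega)
  have h₂ : j < i + 1 := hk.strictMono.lt_iff_lt.1 (by omega)
  omega

/-- Finite words prescribed on the blocks of a factorization fit together to an infinite word. -/
theorem IsCutting.exists_glue {k : ℕ → ℕ} (hk : IsCutting k) (v : ℕ → ℕ → Γ) :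
    ∃ w : ℕ → Γ, ∀ i m, k i + m < k (i + 1) → w (k i + m) = v i m := by
  choose idx off h₁ h₂ using hk.exists_block
  refine ⟨fun n => v (idx n) (off n), fun i m h => ?_⟩
  have hi : idx (k i + m) = i :=
    hk.block_unique (n := k i + m) (by have := h₁ (k i + m); omega)
      (by have := h₁ (k i + m); have := h₂ (k i + m); omega) (by omega) h
  have ho := h₁ (k i + m)
  rw [hi] at ho
  simp only [hi]
  congr 1
  omega

theorem IsCutting.tail {k : ℕ → ℕ} (hk : IsCutting k) (i : ℕ) :
    IsCutting fun j => k (i + j) - k i where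
  strictMono := by
    refine strictMono_nat_of_lt_succ fun j => ?_
    have h₁ := hk.lt (i + j)
    have h₂ := hk.strictMono.monotone (Nat.le_add_right i j)
    rw [← add_assoc]
    omega
  zero := by simp

theorem IsCutting.blockState_tail {k : ℕ → ℕ} (hk : IsCutting k) (δ : Q → Γ → Q) (q : Q)
    (u : ℕ → Γ) (i j : ℕ) :
    blockState δ q (dropWord u (k i)) (fun j => k (i + j) - k i) j =
      blockState δ q u k (i + j) := by
  have h₁ := hk.strictMono.monotone (Nat.le_add_right i j)
  have h₂ := hk.lt (i + j)
  simp only [blockState, dropWord_dropWord]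
  rw [← add_assoc, show k i + (k (i + j) - k i) = k (i + j) by omega,
    show k (i + j + 1) - k i - (k (i + j) - k i) = k (i + j + 1) - k (i + j) by omega]

theorem Recognizes.eq_dropWord {δ : Q → Γ → Q} {q : Q} {g : (ℕ → Γ) → α}
    (h : Recognizes δ q g) {u u' : ℕ → Γ} {k k' : ℕ → ℕ} (hk : IsCutting k) (hk' : IsCutting k')
    (hb : ∀ i, blockState δ q u k i = blockState δ q u' k' i) (i : ℕ) :
    g (dropWord u (k i)) = g (dropWord u' (k' i)) :=
  h (hk.tail i) (hk'.tail i) fun j => by rw [hk.blockState_tail, hk'.blockState_tail, hb]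

/-- An automaton that simulates a recognizing automaton recognizes as well. -/
theorem Recognizes.of_simulation {Q' : Type*} {δ : Q → Γ → Q} {q : Q} {g : (ℕ → Γ) → α}
    (h : Recognizes δ q g) {δ' : Q' → Γ → Q'} {q' : Q'} (p : Q' → Q) (hq : p q' = q)
    (hp : ∀ r a, p (δ' r a) = δ (p r) a) : Recognizes δ' q' g := by
  have key : ∀ u n, p (stateAfter δ' q' u n) = stateAfter δ q u n := by
    intro u n
    induction n with
    | zero => exact hq
    | succ n ih => simp only [stateAfter, hp, ih]
  intro u u' k k' hk hk' hb
  refine h hk hk' fun i => ?_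
  have := congrArg p (hb i)
  simpa only [blockState, key] using this

theorem Recognizes.recognizable [Finite Q] {δ : Q → Γ → Q} {q : Q} {g : (ℕ → Γ) → α}
    (h : Recognizes δ q g) {n : ℕ} (hn : Nat.card Q ≤ n) : Recognizable n g := by
  let e := Finite.equivFin Q
  refine ⟨Fin (Nat.card Q), inferInstance, fun i a => e (δ (e.symm i) a), e q, by simpa, ?_⟩
  exact h.of_simulation e.symm (by simp) (by simp)

theorem Recognizable.mono {n m : ℕ} {g : (ℕ → Γ) → α} (h : Recognizable n g) (hnm : n ≤ m) :
    Recognizable m g := by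
  obtain ⟨Q, hQ, δ, q, hn, hr⟩ := h
  exact ⟨Q, hQ, δ, q, hn.trans hnm, hr⟩

theorem Recognizable.map {n : ℕ} {g : (ℕ → Γ) → α} (h : Recognizable n g) (F : α → β) :
    Recognizable n fun u => F (g u) := by
  obtain ⟨Q, hQ, δ, q, hn, hr⟩ := h
  exact ⟨Q, hQ, δ, q, hn, fun u u' k k' hk hk' hb => congrArg F (hr hk hk' hb)⟩

theorem Recognizable.comap {n : ℕ} {g : (ℕ → Γ) → α} (h : Recognizable n g) (c : Δ → Γ) :
    Recognizable n fun u : ℕ → Δ => g fun i => c (u i) := by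
  obtain ⟨Q, hQ, δ, q, hn, hr⟩ := h
  refine ⟨Q, hQ, fun r a => δ r (c a), q, hn, fun u u' k k' hk hk' hb => hr hk hk' fun i => ?_⟩
  have key : ∀ (u : ℕ → Δ) n,
      stateAfter (fun r a => δ r (c a)) q u n = stateAfter δ q (fun i => c (u i)) n := by
    intro u n
    induction n with
    | zero => rfl
    | succ n ih => simp only [stateAfter, ih]
  have := hb i
  simp only [blockState, key] at this
  exact this

theorem Recognizable.prodMk {n m : ℕ} {g : (ℕ → Γ) → α} {g' : (ℕ → Γ) → β}
    (h : Recognizable n g) (h' : Recognizable m g') :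
    Recognizable (n * m) fun u => (g u, g' u) := by
  obtain ⟨Q, hQ, δ, q, hn, hr⟩ := h
  obtain ⟨Q', hQ', δ', q', hn', hr'⟩ := h'
  refine ⟨Q × Q', inferInstance, fun r a => (δ r.1 a, δ' r.2 a), (q, q'), ?_, ?_⟩
  · rw [Nat.card_prod]
    exact Nat.mul_le_mul hn hn'
  · intro u u' k k' hk hk' hb
    exact Prod.ext
      ((hr.of_simulation (δ' := fun (r : Q × Q') a => (δ r.1 a, δ' r.2 a)) (q' := (q, q'))
        Prod.fst rfl fun _ _ => rfl) hk hk' hb)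
      ((hr'.of_simulation (δ' := fun (r : Q × Q') a => (δ r.1 a, δ' r.2 a)) (q' := (q, q'))
        Prod.snd rfl fun _ _ => rfl) hk hk' hb)

theorem Recognizable.pi {ι : Type*} [Finite ι] {n : ℕ} {g : ι → (ℕ → Γ) → α}
    (h : ∀ i, Recognizable n (g i)) : Recognizable (n ^ Nat.card ι) fun u i => g i u := by
  choose Q hQ δ q hn hr using h
  have hrec : Recognizes (fun (r : ∀ i, Q i) a i => δ i (r i) a) q fun u i => g i u := by
    intro u u' k k' hk hk' hb
    funext i
    exact (hr i).of_simulation (δ' := fun (r : ∀ i, Q i) a i => δ i (r i) a) (q' := q)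
      (fun r => r i) rfl (fun _ _ => rfl) hk hk' hb
  refine hrec.recognizable ?_
  have := Fintype.ofFinite ι
  rw [Nat.card_pi, Nat.card_eq_fintype_card, ← Finset.card_univ]
  exact Finset.prod_le_pow_card _ _ _ fun i _ => hn i

theorem mem_stateAfter_image {δ : Q → Γ → Q} {q : Q} (R : Δ → Γ → Prop) (u : ℕ → Δ) (n : ℕ)
    [Nonempty Γ] (r : Q) :
    r ∈ stateAfter (fun (A : Set Q) a => {r | ∃ r' ∈ A, ∃ b, R a b ∧ δ r' b = r}) {q} u n ↔
      ∃ v : ℕ → Γ, (∀ m < n, R (u m) (v m)) ∧ stateAfter δ q v n = r := by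
  induction n generalizing r with
  | zero =>
    obtain ⟨b⟩ := ‹Nonempty Γ›
    simp only [stateAfter, Set.mem_singleton_iff]
    exact ⟨fun h => ⟨fun _ => b, by simp, h.symm⟩, fun ⟨_, _, h⟩ => h.symm⟩
  | succ n ih =>
    simp only [stateAfter, Set.mem_ofPred_eq]
    constructor
    · rintro ⟨r', hr', b, hb, rfl⟩
      obtain ⟨v, hv, rfl⟩ := (ih r').1 hr'
      refine ⟨Function.update v n b, fun m hm => ?_, ?_⟩
      · rcases Nat.lt_succ_iff_lt_or_eq.1 hm with h | rfl
        · rw [Function.update_of_ne h.ne]; exact hv m h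
        · simpa using hb
      · rw [Function.update_self]
        congr 1
        exact stateAfter_congr _ _ fun m hm => Function.update_of_ne hm.ne _ _
    · rintro ⟨v, hv, rfl⟩
      exact ⟨_, (ih _).2 ⟨v, fun m hm => hv m (by omega), rfl⟩, v n, hv n (by omega), rfl⟩

/-- Projection by the subset construction: if words are related letter by letter, then the set of
the values on the words related to a given word is recognizable at the cost of one exponential.
Since it is the whole set of values that is recognized, this covers suprema and infima alike. -/
theorem Recognizable.image {n : ℕ} {g : (ℕ → Γ) → α} (h : Recognizable n g)
    (R : Δ → Γ → Prop) :
    Recognizable (2 ^ n) fun u : ℕ → Δ => {y | ∃ v : ℕ → Γ, (∀ i, R (u i) (v i)) ∧ g v = y} := by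
  obtain ⟨Q, hQ, δ, q, hn, hr⟩ := h
  refine ⟨Set Q, inferInstance, fun A a => {r | ∃ r' ∈ A, ∃ b, R a b ∧ δ r' b = r}, {q}, ?_, ?_⟩
  · have := Fintype.ofFinite Q
    classical
    rw [Nat.card_eq_fintype_card, Fintype.card_set, ← Nat.card_eq_fintype_card]
    exact Nat.pow_le_pow_right (by norm_num) hn
  · have key : ∀ ⦃u u' : ℕ → Δ⦄ ⦃k k' : ℕ → ℕ⦄, IsCutting k → IsCutting k' →
        (∀ i, blockState (fun (A : Set Q) a => {r | ∃ r' ∈ A, ∃ b, R a b ∧ δ r' b = r}) {q} u k i =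
          blockState (fun (A : Set Q) a => {r | ∃ r' ∈ A, ∃ b, R a b ∧ δ r' b = r}) {q} u' k' i) →
        ∀ v : ℕ → Γ, (∀ i, R (u i) (v i)) → ∃ v' : ℕ → Γ, (∀ i, R (u' i) (v' i)) ∧ g v' = g v := by
      intro u u' k k' hk hk' hb v hv
      have : Nonempty Γ := ⟨v 0⟩
      -- Every block of `v` has a counterpart over the corresponding block of `u'`.
      have hex : ∀ i, ∃ v' : ℕ → Γ,
          (∀ m < k' (i + 1) - k' i, R (dropWord u' (k' i) m) (v' m)) ∧
            stateAfter δ q v' (k' (i + 1) - k' i) = blockState δ q v k i := by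
        intro i
        rw [← mem_stateAfter_image]
        change _ ∈ blockState _ _ u' k' i
        rw [← hb i]
        exact (mem_stateAfter_image R _ _ _).2 ⟨dropWord v (k i), fun m _ => hv _, rfl⟩
      choose v' hv' hs using hex
      obtain ⟨w, hw⟩ := hk'.exists_glue v'
      refine ⟨w, fun i => ?_, hr hk' hk fun i => ?_⟩
      · obtain ⟨j, m, rfl, h⟩ := hk'.exists_block i
        rw [hw j m h]
        exact hv' j m (by omega)
      · rw [← hs i]
        exact stateAfter_congr _ _ fun m hm => hw i m (by omega)
    intro u u' k k' hk hk' hb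
    ext y
    constructor
    · rintro ⟨v, hv, rfl⟩
      exact key hk hk' hb v hv
    · rintro ⟨v, hv, rfl⟩
      exact key hk' hk (fun i => (hb i).symm) v hv

end Recognition

/-! ### From recognizable languages to Büchi automata -/

section Buchi

variable {Γ : Type*} {Q : Type*}

/-- The infinite Ramsey argument: every infinite word can be cut into blocks all of which, except
perhaps the first one, lead to the same state. Only consecutive cut positions matter, so that
it suffices to choose each position among the ultrafilter-many ones that are typical for the
previous one. -/
theorem exists_cutting_blockState_eq [Finite Q] (δ : Q → Γ → Q) (q : Q) (u : ℕ → Γ) :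
    ∃ k, IsCutting k ∧ ∃ e, ∀ i, blockState δ q u k (i + 1) = e := by
  let U : Ultrafilter ℕ := Filter.hyperfilter ℕ
  let c : ℕ → ℕ → Q := fun i j => stateAfter δ q (dropWord u i) (j - i)
  have h₁ : ∀ i, ∃ r, ∀ᶠ j in U, c i j = r := fun i =>
    Ultrafilter.eventually_exists_iff.1 (Filter.Eventually.of_forall fun j => ⟨_, rfl⟩)
  choose d hd using h₁
  obtain ⟨e, he⟩ : ∃ e, ∀ᶠ i in U, d i = e :=
    Ultrafilter.eventually_exists_iff.1 (Filter.Eventually.of_forall fun j => ⟨_, rfl⟩)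
  have h₂ : ∀ i, ∃ j, i < j ∧ d j = e ∧ c i j = d i := by
    intro i
    have hlt : ∀ᶠ j in U, i < j := Nat.hyperfilter_le_atTop (Filter.eventually_gt_atTop i)
    exact (hlt.and (he.and (hd i))).exists
  choose next hlt hde hc using h₂
  let k : ℕ → ℕ := fun i => next^[i] 0
  have hk : ∀ i, k (i + 1) = next (k i) := fun i => Function.iterate_succ_apply' next i 0
  refine ⟨k, ⟨strictMono_nat_of_lt_succ fun i => hk i ▸ hlt (k i), rfl⟩, e, fun i => ?_⟩
  change c (k (i + 1)) (k (i + 1 + 1)) = e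
  rw [hk (i + 1), hc, hk i, hde]

/-- A Büchi automaton that guesses a factorization of the input word into blocks, the first one
leading `δ` from `q` to a state `s` and all others to a state `e`, for a pair `(s, e)` satisfying
`good`. Its states are quadruples consisting of the state that the current block has to reach, the
state `e`, the state reached so far on the current block, and a flag that is set exactly when a
block has just been completed. -/
def blockAutomaton {α : Type*} [Finite α] {Q : Type} [Finite Q] (δ : Q → α → Q) (q : Q)
    (good : Q → Q → Prop) : NBA α where
  State := Q × Q × Q × Bool
  init := {x | good x.1 x.2.1 ∧ x.2.2 = (q, false)}
  step := fun x a => {y | y = (x.1, x.2.1, δ x.2.2.1 a, false) ∨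
    (δ x.2.2.1 a = x.1 ∧ y = (x.2.1, x.2.1, q, true))}
  accept := {x | x.2.2.2 = true}

theorem blockAutomaton_accepts_of_cutting {α : Type*} [Finite α] {Q : Type} [Finite Q]
    {δ : Q → α → Q} {q : Q} {good : Q → Q → Prop} {w : ℕ → α} {k : ℕ → ℕ} (hk : IsCutting k)
    {e : Q} (he : ∀ i, blockState δ q w k (i + 1) = e) (hg : good (blockState δ q w k 0) e) :
    w ∈ (blockAutomaton δ q good).language := by
  choose idx off hn hoff using hk.exists_block
  have huniq : ∀ i m, k i + m < k (i + 1) → idx (k i + m) = i ∧ off (k i + m) = m := by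
    intro i m h
    have h₁ := hn (k i + m)
    have h₂ := hoff (k i + m)
    have : idx (k i + m) = i :=
      hk.block_unique (n := k i + m) (by omega) (by omega) (by omega) h
    rw [this] at h₁
    exact ⟨this, by omega⟩
  let t : ℕ → Q := fun i => blockState δ q w k i
  let r : ℕ → Q × Q × Q × Bool := fun n =>
    (t (idx n), e, stateAfter δ q (dropWord w (k (idx n))) (off n),
      decide (off n = 0 ∧ idx n ≠ 0))
  have hr : ∀ i m, k i + m < k (i + 1) → r (k i + m) =
      (t i, e, stateAfter δ q (dropWord w (k i)) m, decide (m = 0 ∧ i ≠ 0)) := by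
    intro i m h
    simp only [r, (huniq i m h).1, (huniq i m h).2]
  have hr0 : ∀ i, r (k (i + 1)) = (e, e, q, true) := by
    intro i
    have := hr (i + 1) 0 (by simpa using hk.lt (i + 1))
    simp only [add_zero] at this
    rw [this]
    simp [t, he, stateAfter]
  refine ⟨r, ⟨?_, fun n => ?_⟩, (e, e, q, true), ?_, rfl⟩
  · have := hr 0 0 (by simpa using hk.lt 0)
    rw [add_zero, hk.zero] at this
    rw [this]
    exact ⟨hg, by simp [stateAfter]⟩
  · obtain ⟨i, m, rfl, h⟩ := hk.exists_block n
    rw [hr i m h]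
    by_cases h' : k i + (m + 1) < k (i + 1)
    · left
      rw [add_assoc, hr i (m + 1) h']
      simp [stateAfter, dropWord]
    · right
      have hm : k i + m + 1 = k (i + 1) := by omega
      rw [hm, hr0]
      refine ⟨?_, rfl⟩
      have : k (i + 1) - k i = m + 1 := by omega
      simp [t, blockState, this, stateAfter, dropWord]
  · refine Set.infinite_of_injective_forall_mem (f := fun i => k (i + 1)) ?_ hr0
    exact fun i j h => by simpa using hk.strictMono.injective h

theorem exists_cutting_of_blockAutomaton_accepts {α : Type*} [Finite α] {Q : Type} [Finite Q]
    {δ : Q → α → Q} {q : Q} {good : Q → Q → Prop} {w : ℕ → α}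
    (hw : w ∈ (blockAutomaton δ q good).language) :
    ∃ k, IsCutting k ∧ ∃ e, (∀ i, blockState δ q w k (i + 1) = e) ∧
      good (blockState δ q w k 0) e := by
  obtain ⟨r, ⟨⟨hgood, hinit⟩, hstep⟩, x, hinf, hx⟩ := hw
  change ℕ → Q × Q × Q × Bool at r
  have hflag : ∀ i, ∃ j, i < j ∧ (r j).2.2.2 = true := fun i => by
    obtain ⟨j, hj, hij⟩ := hinf.exists_gt i
    have hj : r j = x := hj
    exact ⟨j, hij, hj ▸ hx⟩
  classical
  let next : ℕ → ℕ := fun i => Nat.find (hflag i)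
  have hlt : ∀ i, i < next i := fun i => (Nat.find_spec (hflag i)).1
  have hnext : ∀ i, (r (next i)).2.2.2 = true := fun i => (Nat.find_spec (hflag i)).2
  have hmin : ∀ i j, i < j → j < next i → (r j).2.2.2 = false := fun i j h h' => by
    have := Nat.find_min (hflag i) h'
    simpa [h] using this
  -- A set flag means that a block has just been completed.
  have htrue : ∀ n, (r (n + 1)).2.2.2 = true →
      δ (r n).2.2.1 (w n) = (r n).1 ∧ r (n + 1) = ((r n).2.1, (r n).2.1, q, true) := by
    intro n h
    rcases hstep n with h' | h'
    · rw [h'] at h; simp at h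
    · exact h'
  have hfalse : ∀ n, (r (n + 1)).2.2.2 = false →
      r (n + 1) = ((r n).1, (r n).2.1, δ (r n).2.2.1 (w n), false) := by
    intro n h
    rcases hstep n with h' | h'
    · exact h'
    · rw [h'.2] at h; simp at h
  have hblock : ∀ i, (r i).2.2.1 = q → ∀ m, i + m < next i →
      (r (i + m)).1 = (r i).1 ∧ (r (i + m)).2.1 = (r i).2.1 ∧
        (r (i + m)).2.2.1 = stateAfter δ q (dropWord w i) m := by
    intro i hi m
    induction m with
    | zero => intro _; exact ⟨rfl, rfl, hi⟩
    | succ m ih =>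
      intro h
      obtain ⟨h₁, h₂, h₃⟩ := ih (by omega)
      have := hfalse (i + m) (hmin i _ (by omega) (by omega))
      rw [← add_assoc, this]
      exact ⟨h₁, h₂, by simp [h₃, stateAfter, dropWord]⟩
  have hjump : ∀ i, (r i).2.2.1 = q →
      stateAfter δ q (dropWord w i) (next i - i) = (r i).1 ∧
        r (next i) = ((r i).2.1, (r i).2.1, q, true) := by
    intro i hi
    have hl := hlt i
    obtain ⟨m, hm⟩ : ∃ m, next i = i + m + 1 := ⟨next i - i - 1, by omega⟩
    obtain ⟨h₁, h₂, h₃⟩ := hblock i hi m (by omega)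
    have := htrue (i + m) (hm ▸ hnext i)
    rw [hm, this.2, h₂]
    refine ⟨?_, rfl⟩
    rw [show i + m + 1 - i = m + 1 by omega, ← h₁, ← this.1, h₃]
    rfl
  let k : ℕ → ℕ := fun i => next^[i] 0
  have hk : ∀ i, k (i + 1) = next (k i) := fun i => Function.iterate_succ_apply' next i 0
  have hinit' : (r 0).2.2.1 = q := congrArg Prod.fst hinit
  have hks : ∀ i, r (k (i + 1)) = ((r 0).2.1, (r 0).2.1, q, true) := by
    intro i
    induction i with
    | zero => rw [hk 0]; exact (hjump 0 hinit').2
    | succ i ih =>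
      rw [hk (i + 1), (hjump (k (i + 1)) (by rw [ih])).2, ih]
  refine ⟨k, ⟨strictMono_nat_of_lt_succ fun i => hk i ▸ hlt (k i), rfl⟩, (r 0).2.1, fun i => ?_, ?_⟩
  · have := (hjump (k (i + 1)) (by rw [hks i])).1
    rw [hks i] at this
    rw [blockState, hk (i + 1)]
    exact this
  · have := (hjump 0 hinit').1
    rw [blockState, hk 0]
    change good (stateAfter δ q (dropWord w 0) (next 0 - 0)) _
    rw [this]
    exact hgood

theorem NBA.size_le {α : Type*} [Finite α] (A : NBA α) :
    A.size ≤ Nat.card A.State + Nat.card A.State * (Nat.card α * Nat.card A.State) := by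
  have := A.finiteState
  rw [NBA.size, ← Nat.card_prod, ← Nat.card_prod]
  exact Nat.add_le_add_left (Finite.card_subtype_le _) _

/-- A recognizable language is accepted by a Büchi automaton of polynomial size. -/
theorem Recognizable.exists_nba {α : Type*} [Finite α] {n : ℕ} {g : (ℕ → α) → Prop}
    (h : Recognizable n g) :
    ∃ A : NBA α, A.language = {w | g w} ∧
      A.size ≤ n * (n * (n * 2)) + n * (n * (n * 2)) * (Nat.card α * (n * (n * (n * 2)))) := by
  obtain ⟨Q, hQ, δ, q, hn, hr⟩ := h
  refine ⟨blockAutomaton δ q fun s e => ∃ w, g w ∧ ∃ k, IsCutting k ∧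
    blockState δ q w k 0 = s ∧ ∀ i, blockState δ q w k (i + 1) = e, ?_, ?_⟩
  · ext w
    constructor
    · intro hw
      obtain ⟨k, hk, e, he, w', hw', k', hk', h₀, he'⟩ :=
        exists_cutting_of_blockAutomaton_accepts hw
      have : g w' = g w := hr hk' hk fun i => by
        cases i with
        | zero => exact h₀
        | succ i => rw [he, he']
      exact (show g w from this ▸ hw')
    · intro hw
      obtain ⟨k, hk, e, he⟩ := exists_cutting_blockState_eq δ q w
      exact blockAutomaton_accepts_of_cutting hk he ⟨w, hw, k, hk, rfl, he⟩
  · refine (NBA.size_le _).trans ?_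
    have hc : Nat.card (Q × Q × Q × Bool) ≤ n * (n * (n * 2)) := by
      rw [Nat.card_prod, Nat.card_prod, Nat.card_prod, Nat.card_eq_fintype_card (α := Bool),
        Fintype.card_bool]
      gcongr
    change Nat.card (Q × Q × Q × Bool) + Nat.card (Q × Q × Q × Bool) *
      (Nat.card α * Nat.card (Q × Q × Q × Bool)) ≤ _
    gcongr

end Buchi

/-! ### Backward evaluation -/

section Backward

variable {Γ : Type*}

/-- The action of a letter on the transformers of a set `Y`: `step` reads letters from right to
left, so the transformer of a word is extended on the right by precomposition. -/
def transfer {Y : Type*} (step : Γ → Y → Y) : (Y → Y) → Γ → Y → Y := fun T a => T ∘ step a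

/-- A function `val` on infinite words with values in a finite set that can be computed backwards,
from its value on the suffix and the first letter, and that is determined by the transformers of
the blocks of any factorization of the word. -/
structure BackwardEvaluator (Γ : Type*) where
  /-- the finite set of values -/
  Y : Type
  [finite : Finite Y]
  /-- the value on a word, given its first letter and the value on the remaining suffix -/
  step : Γ → Y → Y
  /-- the value on an infinite word -/
  val : (ℕ → Γ) → Y
  val_eq : ∀ u, val u = step (u 0) (val (dropWord u 1))
  recognizes : Recognizes (transfer step) id val

attribute [instance] BackwardEvaluator.finite

theorem stateAfter_transfer_add {Y : Type*} (step : Γ → Y → Y) (u : ℕ → Γ) (m n : ℕ) :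
    stateAfter (transfer step) id u (m + n) =
      stateAfter (transfer step) id u m ∘ stateAfter (transfer step) id (dropWord u m) n := by
  induction n with
  | zero => rfl
  | succ n ih =>
    rw [← add_assoc, stateAfter, ih]
    rfl

theorem stateAfter_transfer_succ {Y : Type*} (step : Γ → Y → Y) (u : ℕ → Γ) (n : ℕ) (y : Y) :
    stateAfter (transfer step) id u (n + 1) y =
      step (u 0) (stateAfter (transfer step) id (dropWord u 1) n y) := by
  rw [add_comm, stateAfter_transfer_add]
  rfl

/-- The transformer of a finite prefix of a word is the composition of those of its blocks. -/
theorem stateAfter_transfer_eq_of_blockState_eq {Y : Type*} {step : Γ → Y → Y} {u u' : ℕ → Γ}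
    {k k' : ℕ → ℕ} (hk : IsCutting k) (hk' : IsCutting k')
    (hb : ∀ i, blockState (transfer step) id u k i = blockState (transfer step) id u' k' i)
    (i : ℕ) :
    stateAfter (transfer step) id u (k i) = stateAfter (transfer step) id u' (k' i) := by
  induction i with
  | zero => rw [hk.zero, hk'.zero]; rfl
  | succ i ih =>
    have h := hk.lt i
    have h' := hk'.lt i
    rw [show k (i + 1) = k i + (k (i + 1) - k i) by omega,
      show k' (i + 1) = k' i + (k' (i + 1) - k' i) by omega, stateAfter_transfer_add,
      stateAfter_transfer_add, ih]
    exact congrArg _ (hb i)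

theorem val_eq_stateAfter {Y : Type*} {step : Γ → Y → Y} {val : (ℕ → Γ) → Y}
    (h : ∀ u, val u = step (u 0) (val (dropWord u 1))) (u : ℕ → Γ) (n : ℕ) :
    val u = stateAfter (transfer step) id u n (val (dropWord u n)) := by
  induction n with
  | zero => simp [stateAfter]
  | succ n ih =>
    rw [ih, h (dropWord u n), dropWord_dropWord]
    rfl

/-- If `p` is a surjective morphism of backward steps, then recognition by transformers lifts
along `p`. Surjectivity is what makes the transformers downstairs functions of those upstairs. -/
theorem Recognizes.of_transfer_factor {Y Z : Type*} {α : Type*} {step : Γ → Y → Y}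
    {step' : Γ → Z → Z} {g : (ℕ → Γ) → α} (h : Recognizes (transfer step') id g) (p : Y → Z)
    (hp : Function.Surjective p) (hs : ∀ a y, p (step a y) = step' a (p y)) :
    Recognizes (transfer step) id g := by
  have key : ∀ u n y, p (stateAfter (transfer step) id u n y) =
      stateAfter (transfer step') id u n (p y) := by
    intro u n
    induction n with
    | zero => intro y; rfl
    | succ n ih =>
      intro y
      change p (stateAfter (transfer step) id u n (step (u n) y)) =
        stateAfter (transfer step') id u n (step' (u n) (p y))
      rw [ih, hs]
  intro u u' k k' hk hk' hb
  refine h hk hk' fun i => ?_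
  funext z
  obtain ⟨y, rfl⟩ := hp z
  have := congrArg p (congrFun (hb i) y)
  simpa only [blockState, key] using this

namespace BackwardEvaluator

/-- The evaluator with one value. -/
def trivial (Γ : Type*) : BackwardEvaluator Γ where
  Y := Unit
  step := fun _ _ => ()
  val := fun _ => ()
  val_eq := fun _ => rfl
  recognizes := fun _ _ _ _ _ _ _ => rfl

/-- The evaluator of a function of the first letter of a word. -/
def head {Y : Type} [Finite Y] (c : Γ → Y) : BackwardEvaluator Γ where
  Y := Y
  step := fun a _ => c a
  val := fun u => c (u 0)
  val_eq := fun _ => rfl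
  recognizes := by
    intro u u' k k' hk hk' hb
    have key : ∀ (u : ℕ → Γ) {k}, IsCutting k →
        blockState (transfer fun a (_ : Y) => c a) id u k 0 = fun _ => c (u 0) := by
      intro u k hk
      obtain ⟨m, hm⟩ : ∃ m, k (0 + 1) - k 0 = m + 1 := hk.exists_length
      funext y
      rw [blockState, hm, stateAfter_transfer_succ, hk.zero, dropWord_zero]
    have := hb 0
    rw [key u hk, key u' hk'] at this
    exact congrFun this (c (u 0))

/-- The product of finitely many evaluators. -/
def pi {ι : Type} [Finite ι] (E : ι → BackwardEvaluator Γ) : BackwardEvaluator Γ where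
  Y := ∀ i, (E i).Y
  step := fun a y i => (E i).step a (y i)
  val := fun u i => (E i).val u
  val_eq := fun u => funext fun i => (E i).val_eq u
  recognizes := by
    classical
    intro u u' k k' hk hk' hb
    funext i
    refine (E i).recognizes.of_transfer_factor (step := fun a y i => (E i).step a (y i))
      (fun y : ∀ i, (E i).Y => y i) (fun z => ?_) (fun _ _ => rfl) hk hk' hb
    exact ⟨Function.update (fun j => (E j).val u) i z, Function.update_self ..⟩

/-- The evaluator of the values on a word and on its suffix from position `1`. -/
def next (E : BackwardEvaluator Γ) : BackwardEvaluator Γ where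
  Y := E.Y × E.Y
  step := fun a y => (E.step a y.1, y.1)
  val := fun u => (E.val u, E.val (dropWord u 1))
  val_eq := fun u => by rw [← E.val_eq]
  recognizes := by
    intro u u' k k' hk hk' hb
    let step : Γ → E.Y × E.Y → E.Y × E.Y := fun a y => (E.step a y.1, y.1)
    let val : (ℕ → Γ) → E.Y × E.Y := fun u => (E.val u, E.val (dropWord u 1))
    have hval : ∀ u, val u = step (u 0) (val (dropWord u 1)) := fun u => by
      change (_, _) = (_, _)
      rw [E.val_eq u]
    have hrec : Recognizes (transfer step) id E.val :=
      E.recognizes.of_transfer_factor Prod.fst (fun z => ⟨(z, z), rfl⟩) fun _ _ => rfl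
    -- The second component at the next cut is not yet known to agree on both words, but the
    -- transformer of a non-empty block discards it.
    have hdep : ∀ y z, y.1 = z.1 → blockState (transfer step) id u k 0 y =
        blockState (transfer step) id u k 0 z := by
      intro y z h
      obtain ⟨m, hm⟩ : ∃ m, k (0 + 1) - k 0 = m + 1 := hk.exists_length
      rw [blockState, hm]
      change stateAfter (transfer step) id _ m (step _ y) =
        stateAfter (transfer step) id _ m (step _ z)
      simp only [step, h]
    have hv := val_eq_stateAfter hval u (k 1)
    have hv' := val_eq_stateAfter hval u' (k' 1)
    have e : stateAfter (transfer step) id u (k 1) = blockState (transfer step) id u k 0 := by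
      rw [blockState, hk.zero, dropWord_zero]; rfl
    have e' : stateAfter (transfer step) id u' (k' 1) = blockState (transfer step) id u k 0 := by
      rw [stateAfter_transfer_eq_of_blockState_eq hk hk' hb 1 |>.symm, e]
    rw [e] at hv
    rw [e'] at hv'
    change val u = val u'
    rw [hv, hv']
    exact hdep _ _ (hrec.eq_dropWord hk hk' hb 1)

end BackwardEvaluator

/-- The quantitative semantics of the until operator. -/
noncomputable def untilValue (g₁ g₂ : (ℕ → Γ) → I) (u : ℕ → Γ) : I :=
  ⨆ i : ℕ, g₂ (dropWord u i) ⊓ ⨅ j : ℕ, ⨅ _ : j < i, g₁ (dropWord u j)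

/-- The value of the until operator if its second argument may only be reached at one of the first
`n` positions. -/
noncomputable def boundedUntilValue (g₁ g₂ : (ℕ → Γ) → I) : ℕ → (ℕ → Γ) → I
  | 0, _ => 0
  | n + 1, u => g₂ u ⊔ (g₁ u ⊓ boundedUntilValue g₁ g₂ n (dropWord u 1))

theorem untilValue_eq (g₁ g₂ : (ℕ → Γ) → I) (u : ℕ → Γ) :
    untilValue g₁ g₂ u = g₂ u ⊔ (g₁ u ⊓ untilValue g₁ g₂ (dropWord u 1)) := by
  have hinf : ∀ i, ⨅ j : ℕ, ⨅ _ : j < i + 1, g₁ (dropWord u j) =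
      g₁ u ⊓ ⨅ j : ℕ, ⨅ _ : j < i, g₁ (dropWord (dropWord u 1) j) := by
    intro i
    apply le_antisymm
    · refine le_inf ?_ (le_iInf₂ fun j hj => ?_)
      · exact (iInf₂_le 0 (by omega)).trans_eq (by rw [dropWord_zero])
      · rw [dropWord_dropWord, add_comm 1 j]
        exact iInf₂_le (j + 1) (by omega)
    · refine le_iInf₂ fun j hj => ?_
      cases j with
      | zero => rw [dropWord_zero]; exact inf_le_left
      | succ j =>
        refine inf_le_right.trans ((iInf₂_le j (by omega)).trans_eq ?_)
        rw [dropWord_dropWord, add_comm 1 j]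
  rw [untilValue, ← sup_iSup_nat_succ, untilValue, inf_iSup_eq]
  congr 1
  · simp
  · refine iSup_congr fun i => ?_
    rw [hinf, dropWord_dropWord, add_comm 1 i, inf_left_comm]

theorem boundedUntilValue_le (g₁ g₂ : (ℕ → Γ) → I) (n : ℕ) (u : ℕ → Γ) :
    boundedUntilValue g₁ g₂ n u ≤ untilValue g₁ g₂ u := by
  induction n generalizing u with
  | zero => exact bot_le
  | succ n ih =>
    rw [untilValue_eq, boundedUntilValue]
    gcongr
    exact ih _

theorem boundedUntilValue_mono (g₁ g₂ : (ℕ → Γ) → I) {m n : ℕ} (h : m ≤ n) (u : ℕ → Γ) :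
    boundedUntilValue g₁ g₂ m u ≤ boundedUntilValue g₁ g₂ n u := by
  induction m generalizing n u with
  | zero => exact bot_le
  | succ m ih =>
    obtain ⟨n, rfl⟩ : ∃ n', n = n' + 1 := ⟨n - 1, by omega⟩
    rw [boundedUntilValue, boundedUntilValue]
    gcongr
    exact ih (by omega) _

theorem iSup_boundedUntilValue (g₁ g₂ : (ℕ → Γ) → I) (u : ℕ → Γ) :
    ⨆ n, boundedUntilValue g₁ g₂ n u = untilValue g₁ g₂ u := by
  refine le_antisymm (iSup_le fun n => boundedUntilValue_le _ _ _ _) (iSup_le fun i => ?_)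
  refine le_trans ?_ (le_iSup _ (i + 1))
  induction i generalizing u with
  | zero =>
    rw [boundedUntilValue, dropWord_zero]
    exact inf_le_left.trans le_sup_left
  | succ i ih =>
    rw [boundedUntilValue]
    refine le_trans (le_inf ?_ ?_) le_sup_right
    · exact inf_le_right.trans ((iInf₂_le 0 (by omega)).trans_eq (by rw [dropWord_zero]))
    · refine le_trans (le_inf ?_ ?_) (ih (dropWord u 1))
      · rw [dropWord_dropWord, add_comm 1 i]; exact inf_le_left
      · refine inf_le_right.trans (le_iInf₂ fun j hj => ?_)
        rw [dropWord_dropWord, add_comm 1 j]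
        exact iInf₂_le (j + 1) (by omega)

/-- Restricting the reachable positions to those before the cuts of a factorization does not change
the supremum. -/
theorem iSup_boundedUntilValue_cutting (g₁ g₂ : (ℕ → Γ) → I) (u : ℕ → Γ) {k : ℕ → ℕ}
    (hk : IsCutting k) : ⨆ i, boundedUntilValue g₁ g₂ (k i) u = untilValue g₁ g₂ u := by
  rw [← iSup_boundedUntilValue]
  refine le_antisymm (iSup_le fun i => le_iSup (fun n => boundedUntilValue g₁ g₂ n u) (k i))
    (iSup_le fun n => ?_)
  exact (boundedUntilValue_mono _ _ hk.strictMono.le_apply u).trans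
    (le_iSup (fun i => boundedUntilValue g₁ g₂ (k i) u) n)

namespace BackwardEvaluator

/-- A finite set of values that contains those of the until operator. -/
def untilRange {Y₁ Y₂ : Type} (out₁ : Y₁ → I) (out₂ : Y₂ → I) : Set I :=
  insert 0 (Set.range out₁ ∪ Set.range out₂)

theorem finite_untilRange {Y₁ Y₂ : Type} [Finite Y₁] [Finite Y₂] (out₁ : Y₁ → I)
    (out₂ : Y₂ → I) : (untilRange out₁ out₂).Finite :=
  ((Set.finite_range _).union (Set.finite_range _)).insert _

theorem sup_inf_mem_untilRange {Y₁ Y₂ : Type} (out₁ : Y₁ → I) (out₂ : Y₂ → I) (y₁ : Y₁) (y₂ : Y₂)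
    {r : I} (hr : r ∈ untilRange out₁ out₂) :
    out₂ y₂ ⊔ (out₁ y₁ ⊓ r) ∈ untilRange out₁ out₂ := by
  have h₁ : out₁ y₁ ∈ untilRange out₁ out₂ := Or.inr (Or.inl ⟨y₁, rfl⟩)
  have h₂ : out₂ y₂ ∈ untilRange out₁ out₂ := Or.inr (Or.inr ⟨y₂, rfl⟩)
  rcases le_total (out₁ y₁) r with h | h
  · rw [inf_eq_left.2 h]
    rcases le_total (out₂ y₂) (out₁ y₁) with h' | h'
    · rwa [sup_eq_right.2 h']
    · rwa [sup_eq_left.2 h']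
  · rw [inf_eq_right.2 h]
    rcases le_total (out₂ y₂) r with h' | h'
    · rwa [sup_eq_right.2 h']
    · rwa [sup_eq_left.2 h']

theorem untilValue_mem_untilRange (E₁ E₂ : BackwardEvaluator Γ) (out₁ : E₁.Y → I)
    (out₂ : E₂.Y → I) (u : ℕ → Γ) :
    untilValue (fun u => out₁ (E₁.val u)) (fun u => out₂ (E₂.val u)) u ∈
      untilRange out₁ out₂ := by
  have hb : ∀ n u, boundedUntilValue (fun u => out₁ (E₁.val u)) (fun u => out₂ (E₂.val u)) n u ∈
      untilRange out₁ out₂ := by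
    intro n
    induction n with
    | zero => exact fun u => Or.inl rfl
    | succ n ih => exact fun u => sup_inf_mem_untilRange _ _ _ _ (ih _)
  rw [← iSup_boundedUntilValue]
  have hsub : Set.range (fun n => boundedUntilValue (fun u => out₁ (E₁.val u))
      (fun u => out₂ (E₂.val u)) n u) ⊆ untilRange out₁ out₂ := by
    rintro _ ⟨n, rfl⟩
    exact hb n u
  exact hsub ((Set.range_nonempty _).csSup_mem ((finite_untilRange out₁ out₂).subset hsub))

/-- The backward step of the until operator, by its expansion law. -/
noncomputable def untilStep (E₁ E₂ : BackwardEvaluator Γ) (out₁ : E₁.Y → I) (out₂ : E₂.Y → I)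
    (a : Γ) (y : E₁.Y × E₂.Y × untilRange out₁ out₂) : E₁.Y × E₂.Y × untilRange out₁ out₂ :=
  (E₁.step a y.1, E₂.step a y.2.1, ⟨out₂ (E₂.step a y.2.1) ⊔ (out₁ (E₁.step a y.1) ⊓ y.2.2.1),
    sup_inf_mem_untilRange _ _ _ _ y.2.2.2⟩)

theorem stateAfter_untilStep (E₁ E₂ : BackwardEvaluator Γ) (out₁ : E₁.Y → I) (out₂ : E₂.Y → I)
    (u : ℕ → Γ) (n : ℕ) :
    let z := stateAfter (transfer (untilStep E₁ E₂ out₁ out₂)) id u n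
      (E₁.val (dropWord u n), E₂.val (dropWord u n), ⟨0, Or.inl rfl⟩)
    z.1 = E₁.val u ∧ z.2.1 = E₂.val u ∧ (z.2.2 : I) =
      boundedUntilValue (fun u => out₁ (E₁.val u)) (fun u => out₂ (E₂.val u)) n u := by
  induction n generalizing u with
  | zero => simp [stateAfter, boundedUntilValue]
  | succ n ih =>
    have h := ih (dropWord u 1)
    rw [dropWord_dropWord, add_comm 1 n] at h
    obtain ⟨h₁, h₂, h₃⟩ := h
    rw [stateAfter_transfer_succ]
    simp only [untilStep, h₁, h₂, h₃, boundedUntilValue, ← E₁.val_eq, ← E₂.val_eq, and_self]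

/-- The evaluator of the until operator. Its value is a least fixed point of the expansion law:
it is the supremum of what the prefixes of the word contribute, and on a prefix ending at a cut
this contribution is obtained by applying the transformers of the blocks to the value `0`. -/
noncomputable def untl (E₁ E₂ : BackwardEvaluator Γ) (out₁ : E₁.Y → I) (out₂ : E₂.Y → I) :
    BackwardEvaluator Γ where
  Y := E₁.Y × E₂.Y × untilRange out₁ out₂
  finite := by
    have := (finite_untilRange out₁ out₂).to_subtype
    infer_instance
  step := untilStep E₁ E₂ out₁ out₂
  val := fun u => (E₁.val u, E₂.val u,
    ⟨untilValue (fun u => out₁ (E₁.val u)) (fun u => out₂ (E₂.val u)) u,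
      untilValue_mem_untilRange E₁ E₂ out₁ out₂ u⟩)
  val_eq := fun u => by
    have h := untilValue_eq (fun u => out₁ (E₁.val u)) (fun u => out₂ (E₂.val u)) u
    simp only [untilStep, ← E₁.val_eq, ← E₂.val_eq]
    exact Prod.ext rfl (Prod.ext rfl (Subtype.ext h))
  recognizes := by
    intro u u' k k' hk hk' hb
    have hrec₁ : Recognizes (transfer (untilStep E₁ E₂ out₁ out₂)) id E₁.val :=
      E₁.recognizes.of_transfer_factor Prod.fst
        (fun z => ⟨(z, E₂.val u, ⟨0, Or.inl rfl⟩), rfl⟩) fun _ _ => rfl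
    have hrec₂ : Recognizes (transfer (untilStep E₁ E₂ out₁ out₂)) id E₂.val :=
      E₂.recognizes.of_transfer_factor (fun y => y.2.1)
        (fun z => ⟨(E₁.val u, z, ⟨0, Or.inl rfl⟩), rfl⟩) fun _ _ => rfl
    refine Prod.ext (hrec₁ hk hk' hb) (Prod.ext (hrec₂ hk hk' hb) (Subtype.ext ?_))
    change untilValue (fun u => out₁ (E₁.val u)) (fun u => out₂ (E₂.val u)) u =
      untilValue (fun u => out₁ (E₁.val u)) (fun u => out₂ (E₂.val u)) u'
    rw [← iSup_boundedUntilValue_cutting _ _ u hk, ← iSup_boundedUntilValue_cutting _ _ u' hk']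
    refine iSup_congr fun i => ?_
    rw [← (stateAfter_untilStep E₁ E₂ out₁ out₂ u (k i)).2.2,
      ← (stateAfter_untilStep E₁ E₂ out₁ out₂ u' (k' i)).2.2,
      stateAfter_transfer_eq_of_blockState_eq hk hk' hb i, hrec₁.eq_dropWord hk hk' hb i,
      hrec₂.eq_dropWord hk hk' hb i]

theorem card_untilRange_le {Y₁ Y₂ : Type} [Finite Y₁] [Finite Y₂] (out₁ : Y₁ → I)
    (out₂ : Y₂ → I) : Nat.card (untilRange out₁ out₂) ≤ Nat.card Y₁ + Nat.card Y₂ + 1 := by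
  rw [Nat.card_coe_set_eq]
  refine (Set.ncard_insert_le _ _).trans (Nat.add_le_add_right ?_ 1)
  refine (Set.ncard_union_le _ _).trans (Nat.add_le_add ?_ ?_)
  · rw [← Nat.card_coe_set_eq]; exact Finite.card_range_le out₁
  · rw [← Nat.card_coe_set_eq]; exact Finite.card_range_le out₂

end BackwardEvaluator

end Backward

/-! ### Quantifier-free formulas -/

section QuantifierFree

variable {F : Functions.{w}} {AP : Type u} {V : Type x}

/-- The trace assignment encoded by an infinite word over the alphabet of all valuations of the
propositions `p_π` by weights of `K`. -/
def wordAssignment (K : Kripke.{u, v} AP) (u : ℕ → V → AP → K.weights) : V → Trace AP :=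
  fun π k p => (u k π p : I)

theorem sum_four_pow_le {ι : Type*} (s : Finset ι) (f : ι → ℕ) (hf : ∀ i ∈ s, 1 ≤ f i) :
    ∑ i ∈ s, 4 ^ f i + 1 ≤ 2 * 4 ^ ∑ i ∈ s, f i := by
  classical
  induction s using Finset.induction_on with
  | empty => simp
  | insert i s hi ih =>
    rw [Finset.sum_insert hi, Finset.sum_insert hi, pow_add]
    have h₁ := ih fun j hj => hf j (Finset.mem_insert_of_mem hj)
    have h₂ : 4 ≤ 4 ^ f i := Nat.le_self_pow (by have := hf i (by simp); omega) 4
    have h₃ : 1 ≤ 4 ^ ∑ j ∈ s, f j := Nat.one_le_pow _ _ (by norm_num)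
    nlinarith

theorem QFFormula.one_le_size (φ : QFFormula F AP V) : 1 ≤ φ.size := by
  cases φ <;> grind [size]

/-- Every quantifier-free formula is evaluated backwards with doubly exponentially many values. The
second exponential in the bound absorbs the squaring of the number of values at each `X`. -/
theorem QFFormula.exists_backwardEvaluator (K : Kripke.{u, v} AP) {c : ℕ} (hc : 2 ≤ c)
    (hK : K.weights.card ≤ c) (φ : QFFormula F AP V) :
    ∃ (E : BackwardEvaluator (V → AP → K.weights)) (out : E.Y → I),
      Nat.card E.Y ≤ c ^ 4 ^ φ.size ∧ ∀ u, φ.value (wordAssignment K u) = out (E.val u) := by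
  have hpos : ∀ n, 1 ≤ c ^ n := fun n => Nat.one_le_pow _ _ (by omega)
  induction φ with
  | tt => exact ⟨.trivial _, fun _ => 1, by simpa [BackwardEvaluator.trivial] using hpos _,
      fun _ => rfl⟩
  | ff => exact ⟨.trivial _, fun _ => 0, by simpa [BackwardEvaluator.trivial] using hpos _,
      fun _ => rfl⟩
  | atom p π =>
    refine ⟨.head fun a => a π p, fun y => y.1, ?_, fun _ => rfl⟩
    change Nat.card K.weights ≤ _
    rw [Nat.card_eq_fintype_card, Fintype.card_coe]
    exact hK.trans (Nat.le_self_pow (by simp) c)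
  | app f φ ih =>
    choose E out hcard hval using ih
    refine ⟨.pi E, fun y => F.interp f fun i => out i (y i), ?_, fun u => ?_⟩
    · change Nat.card (∀ i, (E i).Y) ≤ _
      rw [Nat.card_pi]
      refine (Finset.prod_le_prod' fun i _ => hcard i).trans ?_
      rw [Finset.prod_pow_eq_pow_sum, size, pow_add]
      have := sum_four_pow_le Finset.univ (fun i => (φ i).size) fun i _ => (φ i).one_le_size
      exact Nat.pow_le_pow_right (by omega) (by omega)
    · simp only [value, hval]
      rfl
  | next φ ih =>
    obtain ⟨E, out, hcard, hval⟩ := ih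
    refine ⟨.next E, fun y => out y.2, ?_, fun u => hval (dropWord u 1)⟩
    change Nat.card (E.Y × E.Y) ≤ _
    rw [Nat.card_prod, size, pow_add]
    refine (Nat.mul_le_mul hcard hcard).trans ?_
    rw [← pow_add]
    exact Nat.pow_le_pow_right (by omega) (by omega)
  | untl φ₁ φ₂ ih₁ ih₂ =>
    obtain ⟨E₁, out₁, hcard₁, hval₁⟩ := ih₁
    obtain ⟨E₂, out₂, hcard₂, hval₂⟩ := ih₂
    refine ⟨.untl E₁ E₂ out₁ out₂, fun y => y.2.2.1, ?_, fun u => ?_⟩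
    · change Nat.card (E₁.Y × E₂.Y × BackwardEvaluator.untilRange out₁ out₂) ≤ _
      rw [Nat.card_prod, Nat.card_prod, size]
      have h₁ : 4 ≤ 4 ^ φ₁.size := Nat.le_self_pow (by have := φ₁.one_le_size; omega) 4
      have h₂ : 4 ≤ 4 ^ φ₂.size := Nat.le_self_pow (by have := φ₂.one_le_size; omega) 4
      have hsum : c ^ 4 ^ φ₁.size + c ^ 4 ^ φ₂.size + 1 ≤ c ^ (4 ^ φ₁.size + 4 ^ φ₂.size + 2) := by
        have h₃ := hpos (4 ^ φ₁.size)
        have h₄ := hpos (4 ^ φ₂.size)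
        have h₅ : 4 ≤ c ^ 2 := by nlinarith
        rw [pow_add, pow_add]
        have h₆ : c ^ 4 ^ φ₁.size + c ^ 4 ^ φ₂.size + 1 ≤
            (c ^ 4 ^ φ₁.size * c ^ 4 ^ φ₂.size) * 4 := by nlinarith
        exact h₆.trans (Nat.mul_le_mul_left _ h₅)
      have hrange := (BackwardEvaluator.card_untilRange_le out₁ out₂).trans
        ((Nat.add_le_add_right (Nat.add_le_add hcard₁ hcard₂) 1).trans hsum)
      refine (Nat.mul_le_mul hcard₁ (Nat.mul_le_mul hcard₂ hrange)).trans ?_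
      rw [← pow_add, ← pow_add]
      refine Nat.pow_le_pow_right (by omega) ?_
      rw [pow_add, pow_add]
      nlinarith
    · simp only [value]
      exact (congrArg₂ (untilValue · · u) (funext hval₁) (funext hval₂) :)

theorem QFFormula.recognizable (K : Kripke.{u, v} AP) {c : ℕ} (hc : 2 ≤ c)
    (hK : K.weights.card ≤ c) (φ : QFFormula F AP V) :
    Recognizable ((c ^ 4 ^ φ.size) ^ (c ^ 4 ^ φ.size))
      fun u => φ.value (wordAssignment K u) := by
  obtain ⟨E, out, hcard, hval⟩ := φ.exists_backwardEvaluator K hc hK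
  simp only [hval]
  refine Recognizable.map (E.recognizes.recognizable ?_) out
  rw [Nat.card_fun]
  exact (Nat.pow_le_pow_left hcard _).trans
    (Nat.pow_le_pow_right (Nat.pow_pos (by omega)) hcard)

end QuantifierFree

/-! ### Traces of Kripke structures -/

section Traces

variable {AP : Type u}

/-- The traces of a Kripke structure as infinite words over the alphabet of its labels. -/
def Kripke.wordTraces (K : Kripke.{u, v} AP) : Set (ℕ → AP → K.weights) :=
  {t | ∃ s : ℕ → K.State, K.IsPath s ∧ ∀ k, t k = K.label (s k)}

theorem Kripke.mem_traces_of_mem_wordTraces (K : Kripke.{u, v} AP) {t : ℕ → AP → K.weights}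
    (ht : t ∈ K.wordTraces) : (fun k p => (t k p : I)) ∈ K.traces := by
  obtain ⟨s, hs, h⟩ := ht
  exact ⟨s, hs, fun k p => by simp only [h]⟩

theorem Kripke.mem_wordTraces_of_mem_traces (K : Kripke.{u, v} AP) {t : Trace AP}
    (ht : t ∈ K.traces) :
    (fun k p => ⟨t k p, K.mem_weights_of_mem_traces ht k p⟩ : ℕ → AP → K.weights) ∈
      K.wordTraces := by
  obtain ⟨s, hs, h⟩ := ht
  exact ⟨s, hs, fun k => funext fun p => Subtype.ext (h k p)⟩

/-- Extends the reachability relation of a finite word by one letter. -/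
def Kripke.reachStep (K : Kripke.{u, v} AP) (T : K.State → Set K.State) (a : AP → K.weights) :
    K.State → Set K.State :=
  fun s => {s'' | ∃ s' ∈ T s, K.label s' = a ∧ K.trans s' s''}

theorem Kripke.mem_stateAfter_reachStep (K : Kripke.{u, v} AP) (t : ℕ → AP → K.weights) (n : ℕ)
    (s r : K.State) :
    r ∈ stateAfter K.reachStep (fun s => {s}) t n s ↔
      ∃ p : ℕ → K.State, p 0 = s ∧ p n = r ∧
        ∀ m < n, K.label (p m) = t m ∧ K.trans (p m) (p (m + 1)) := by
  induction n generalizing r with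
  | zero =>
    simp only [stateAfter, Set.mem_singleton_iff]
    exact ⟨fun h => ⟨fun _ => s, rfl, h.symm, by simp⟩, fun ⟨p, h, h', _⟩ => h' ▸ h⟩
  | succ n ih =>
    simp only [stateAfter, reachStep, Set.mem_ofPred_eq]
    constructor
    · rintro ⟨r', hr', hl, ht⟩
      obtain ⟨p, rfl, rfl, h⟩ := (ih r').1 hr'
      refine ⟨Function.update p (n + 1) r, by simp, by simp, fun m hm => ?_⟩
      rw [Function.update_of_ne (by omega)]
      rcases Nat.lt_succ_iff_lt_or_eq.1 hm with h' | rfl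
      · rw [Function.update_of_ne (by omega)]
        exact h m h'
      · rw [Function.update_self]
        exact ⟨hl, ht⟩
    · rintro ⟨p, hs, rfl, h⟩
      exact ⟨p n, (ih _).2 ⟨p, hs, rfl, fun m hm => h m (by omega)⟩, h n (by omega)⟩

theorem Kripke.recognizable_mem_wordTraces (K : Kripke.{u, v} AP) :
    Recognizable ((2 ^ Nat.card K.State) ^ Nat.card K.State) (· ∈ K.wordTraces) := by
  have := K.finiteState
  have key : ∀ ⦃t t' : ℕ → AP → K.weights⦄ ⦃k k' : ℕ → ℕ⦄, IsCutting k → IsCutting k' →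
      (∀ i, blockState K.reachStep (fun s => {s}) t k i =
        blockState K.reachStep (fun s => {s}) t' k' i) → t ∈ K.wordTraces →
          t' ∈ K.wordTraces := by
    rintro t t' k k' hk hk' hb ⟨s, ⟨hinit, htrans⟩, hlabel⟩
    -- On each block of `t'` there is a path that starts and ends in the same states as the path `s`
    -- on the corresponding block of `t`, so that these paths fit together.
    have hex : ∀ i, ∃ p : ℕ → K.State, p 0 = s (k i) ∧ p (k' (i + 1) - k' i) = s (k (i + 1)) ∧
        ∀ m < k' (i + 1) - k' i,
          K.label (p m) = dropWord t' (k' i) m ∧ K.trans (p m) (p (m + 1)) := by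
      intro i
      rw [← K.mem_stateAfter_reachStep]
      change _ ∈ blockState K.reachStep (fun s => {s}) t' k' i _
      rw [← hb i]
      refine (K.mem_stateAfter_reachStep _ _ _ _).2 ⟨dropWord s (k i), rfl, ?_, fun m _ => ?_⟩
      · have := hk.lt i
        simp only [dropWord]
        congr 1
        omega
      · exact ⟨(hlabel _).symm, htrans _⟩
    choose p hp0 hp1 hp using hex
    obtain ⟨s', hs'⟩ := hk'.exists_glue p
    have hcut : ∀ i, s' (k' i) = s (k i) := fun i => by
      have := hs' i 0 (by simpa using hk'.lt i)
      rw [add_zero] at this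
      rw [this, hp0]
    refine ⟨s', ⟨?_, fun n => ?_⟩, fun n => ?_⟩
    · have := hcut 0
      rw [hk.zero, hk'.zero] at this
      rwa [this]
    · obtain ⟨i, m, rfl, h⟩ := hk'.exists_block n
      have hnext : s' (k' i + m + 1) = p i (m + 1) := by
        by_cases h' : k' i + (m + 1) < k' (i + 1)
        · exact hs' i (m + 1) h'
        · rw [show k' i + m + 1 = k' (i + 1) by omega, hcut, ← hp1,
            show k' (i + 1) - k' i = m + 1 by omega]
      rw [hnext, hs' i m h]
      exact (hp i m (by omega)).2
    · obtain ⟨i, m, rfl, h⟩ := hk'.exists_block n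
      rw [hs' i m h]
      exact (hp i m (by omega)).1.symm
  have hrec : Recognizes K.reachStep (fun s => {s}) (· ∈ K.wordTraces) :=
    fun t t' k k' hk hk' hb =>
      propext ⟨key hk hk' hb, key hk' hk fun i => (hb i).symm⟩
  refine hrec.recognizable ?_
  have := Fintype.ofFinite K.State
  classical
  rw [Nat.card_fun, Nat.card_eq_fintype_card (α := Set K.State), Fintype.card_set,
    Nat.card_eq_fintype_card]

end Traces

/-! ### Blocks of quantifiers -/

section Blocks

variable {F : Functions.{w}} {AP : Type u} {V : Type x}

/-- The words that arise from `u` by assigning traces of `K` to the variables in `B`. -/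
def reassignments (K : Kripke.{u, v} AP) (B : Finset V) (u : ℕ → V → AP → K.weights) :
    Set (ℕ → V → AP → K.weights) :=
  {v | (∀ k, ∀ π ∉ B, u k π = v k π) ∧ ∀ π ∈ B, (fun k => v k π) ∈ K.wordTraces}

theorem reassignments_empty (K : Kripke.{u, v} AP) (u : ℕ → V → AP → K.weights) :
    reassignments K ∅ u = {u} := by
  ext v
  constructor
  · rintro ⟨h, -⟩
    funext k π
    exact (h k π (by simp)).symm
  · rintro rfl
    exact ⟨fun _ _ _ => rfl, by simp⟩

theorem iUnion_reassignments [DecidableEq V] (K : Kripke.{u, v} AP) (B : Finset V) (π : V)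
    (u : ℕ → V → AP → K.weights) :
    ⋃ t : K.wordTraces, reassignments K B (fun k => Function.update (u k) π (t.1 k)) =
      reassignments K (insert π B) u := by
  ext v
  simp only [Set.mem_iUnion]
  constructor
  · rintro ⟨⟨t, ht⟩, h₁, h₂⟩
    dsimp only at h₁
    refine ⟨fun k π' hπ' => ?_, fun π' hπ' => ?_⟩
    · rw [Finset.mem_insert, not_or] at hπ'
      rw [← h₁ k π' hπ'.2, Function.update_of_ne hπ'.1]
    · by_cases hB : π' ∈ B
      · exact h₂ π' hB
      · obtain rfl : π' = π := (Finset.mem_insert.1 hπ').resolve_right hB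
        have : (fun k => v k π') = t := by
          funext k
          rw [← h₁ k π' hB, Function.update_self]
        rwa [this]
  · rintro ⟨h₁, h₂⟩
    refine ⟨⟨fun k => v k π, h₂ π (Finset.mem_insert_self _ _)⟩, fun k π' hπ' => ?_,
      fun π' hπ' => h₂ π' (Finset.mem_insert_of_mem hπ')⟩
    by_cases h : π' = π
    · subst h; simp
    · dsimp only
      rw [Function.update_of_ne h]
      exact h₁ k π' (by simp [h, hπ'])

/-- Quantifying a whole block of variables costs a single exponential. -/
theorem Recognizable.image_reassignments {α : Type*} (K : Kripke.{u, v} AP) (B : Finset V) {n : ℕ}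
    {g : (ℕ → V → AP → K.weights) → α} (h : Recognizable n g) :
    Recognizable (2 ^ (n * ((2 ^ Nat.card K.State) ^ Nat.card K.State) ^ B.card))
      fun u => g '' reassignments K B u := by
  have hB : Recognizable (((2 ^ Nat.card K.State) ^ Nat.card K.State) ^ B.card)
      fun (u : ℕ → V → AP → K.weights) (π : B) => (fun k => u k π.1) ∈ K.wordTraces := by
    have := Recognizable.pi (ι := B) fun π =>
      K.recognizable_mem_wordTraces.comap fun a : V → AP → K.weights => a π.1
    rwa [Nat.card_eq_fintype_card (α := B), Fintype.card_coe] at this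
  have := ((h.prodMk hB).image fun a b : V → AP → K.weights => ∀ π ∉ B, a π = b π).map
    fun A => {y | ∃ c : B → Prop, (∀ π, c π) ∧ (y, c) ∈ A}
  convert this using 2 with u
  ext y
  constructor
  · rintro ⟨v, ⟨h₁, h₂⟩, rfl⟩
    exact ⟨_, fun π => h₂ π.1 π.2, v, h₁, rfl⟩
  · rintro ⟨c, hc, v, h₁, h₂⟩
    obtain ⟨rfl, rfl⟩ := Prod.ext_iff.1 h₂
    exact ⟨v, ⟨h₁, fun π hπ => hc ⟨π, hπ⟩⟩, rfl⟩

variable [DecidableEq V]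

theorem range_value_update (K : Kripke.{u, v} AP) (ψ : Formula F AP V) (π : V)
    (u : ℕ → V → AP → K.weights) :
    Set.range (fun t : K.traces =>
        ψ.value K.traces (Function.update (wordAssignment K u) π t.1)) =
      Set.range fun t : K.wordTraces =>
        ψ.value K.traces (wordAssignment K fun k => Function.update (u k) π (t.1 k)) := by
  have key : ∀ t : ℕ → AP → K.weights,
      Function.update (wordAssignment K u) π (fun k p => (t k p : I)) =
        wordAssignment K fun k => Function.update (u k) π (t k) := by
    intro t
    funext π'
    by_cases h : π' = π
    · subst h; funext k p; simp [wordAssignment]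
    · funext k p; simp [wordAssignment, Function.update_of_ne h]
  ext r
  constructor
  · rintro ⟨⟨t, ht⟩, rfl⟩
    exact ⟨⟨_, K.mem_wordTraces_of_mem_traces ht⟩, by dsimp only; rw [← key]⟩
  · rintro ⟨⟨t, ht⟩, rfl⟩
    exact ⟨⟨_, K.mem_traces_of_mem_wordTraces ht⟩, by dsimp only; rw [← key]⟩

/-- The value of `ψ` is obtained by applying `op`, a supremum or an infimum, to the values of a
function recognizable with `n` states, the variables bound in the outermost block of quantifiers
of `ψ` ranging over the traces of `K`. -/
def BlockRecognizable (K : Kripke.{u, v} AP) (op : Set I → I) (n : ℕ) (ψ : Formula F AP V) :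
    Prop :=
  ∃ (B : Finset V) (g : (ℕ → V → AP → K.weights) → I), B.card ≤ ψ.size ∧ Recognizable n g ∧
    ∀ u, ψ.value K.traces (wordAssignment K u) = op (g '' reassignments K B u)

theorem blockRecognizable_of_recognizable {K : Kripke.{u, v} AP} {op : Set I → I} {n : ℕ}
    {ψ : Formula F AP V} (hop : ∀ r, op {r} = r)
    (h : Recognizable n fun u => ψ.value K.traces (wordAssignment K u)) :
    BlockRecognizable K op n ψ :=
  ⟨∅, _, by simp, h, fun u => by rw [reassignments_empty, Set.image_singleton, hop]⟩

theorem BlockRecognizable.recognizable {K : Kripke.{u, v} AP} {op : Set I → I} {n : ℕ}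
    {ψ : Formula F AP V} (h : BlockRecognizable K op n ψ) :
    Recognizable (2 ^ (n * ((2 ^ Nat.card K.State) ^ Nat.card K.State) ^ ψ.size))
      fun u => ψ.value K.traces (wordAssignment K u) := by
  obtain ⟨B, g, hB, hg, hval⟩ := h
  simp only [hval]
  refine ((hg.image_reassignments K B).map op).mono ?_
  have : 1 ≤ (2 ^ Nat.card K.State) ^ Nat.card K.State := Nat.one_le_pow _ _ (by positivity)
  gcongr
  norm_num

theorem BlockRecognizable.ex {K : Kripke.{u, v} AP} {n : ℕ} {ψ : Formula F AP V} (π : V)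
    (h : BlockRecognizable K sSup n ψ) : BlockRecognizable K sSup n (.ex π ψ) := by
  obtain ⟨B, g, hB, hg, hval⟩ := h
  refine ⟨insert π B, g, ?_, hg, fun u => ?_⟩
  · have := Finset.card_insert_le π B
    simp only [Formula.size]
    omega
  · rw [Formula.value, ← sSup_range, range_value_update, sSup_range, ← iUnion_reassignments,
      Set.image_iUnion, sSup_iUnion]
    simp only [hval]

theorem BlockRecognizable.all {K : Kripke.{u, v} AP} {n : ℕ} {ψ : Formula F AP V} (π : V)
    (h : BlockRecognizable K sInf n ψ) : BlockRecognizable K sInf n (.all π ψ) := by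
  obtain ⟨B, g, hB, hg, hval⟩ := h
  refine ⟨insert π B, g, ?_, hg, fun u => ?_⟩
  · have := Finset.card_insert_le π B
    simp only [Formula.size]
    omega
  · have hInf : ∀ s : K.wordTraces → Set I, sInf (⋃ t, s t) = ⨅ t, sInf (s t) := fun s =>
      sSup_iUnion (β := Iᵒᵈ) s
    rw [Formula.value, ← sInf_range, range_value_update, sInf_range, ← iUnion_reassignments,
      Set.image_iUnion, hInf]
    simp only [hval]

end Blocks

/-! ### Towers of exponentials -/

section Tower

theorem tower_le_succ (h n : ℕ) : tower h n ≤ tower (h + 1) n :=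
  Nat.lt_two_pow_self.le

theorem tower_mono_left {h h' : ℕ} (hh : h ≤ h') (n : ℕ) : tower h n ≤ tower h' n :=
  monotone_nat_of_le_succ (f := fun h => tower h n) (fun h => tower_le_succ h n) hh

theorem add_le_tower {h n a b : ℕ} (ha : a ≤ tower h n) (hb : b ≤ tower h n) :
    a + b ≤ tower (h + 1) n := by
  have key : ∀ m : ℕ, 2 * m ≤ 2 ^ m := by
    intro m
    cases m with
    | zero => simp
    | succ m =>
      have := Nat.lt_two_pow_self (n := m)
      rw [pow_succ]
      omega
  have := key (tower h n)
  rw [tower]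
  omega

theorem mul_le_tower {h n a b : ℕ} (ha : a ≤ tower h n) (hb : b ≤ tower h n) :
    a * b ≤ tower (h + 2) n := by
  have h₁ := ha.trans (tower_le_succ h n)
  have h₂ := hb.trans (tower_le_succ h n)
  refine (Nat.mul_le_mul h₁ h₂).trans ?_
  rw [tower, tower, ← pow_add]
  exact Nat.pow_le_pow_right (by norm_num) (add_le_tower le_rfl le_rfl)

theorem pow_le_tower {h n a b : ℕ} (ha : a ≤ tower h n) (hb : b ≤ tower h n) :
    a ^ b ≤ tower (h + 3) n := by
  refine (Nat.pow_le_pow_left (ha.trans (tower_le_succ h n)) b).trans ?_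
  rw [tower, tower, ← pow_mul]
  exact Nat.pow_le_pow_right (by norm_num) (mul_le_tower le_rfl hb)

end Tower

/-! ### The automaton of a formula -/

section Formulas

variable {F : Functions.{w}} {AP : Type u} {V : Type x}

theorem card_assigned_le_tower (K : Kripke.{u, v} AP) {m n : ℕ} (hn : m + K.size ≤ n) :
    ((2 ^ Nat.card K.State) ^ Nat.card K.State) ^ m ≤ tower 7 n := by
  have hS : Nat.card K.State ≤ tower 0 n := by simp only [Kripke.size, tower] at hn ⊢; omega
  have hm : m ≤ tower 0 n := by simp only [tower]; omega
  have h₁ : 2 ^ Nat.card K.State ≤ tower 1 n := Nat.pow_le_pow_right (by norm_num) hS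
  exact pow_le_tower (pow_le_tower h₁ (hS.trans (tower_mono_left (by omega) n)))
    (hm.trans (tower_mono_left (by omega) n))

/-- The number of letters is bounded by a tower of constant height. -/
theorem card_letter_le_tower [Finite AP] (K : Kripke.{u, v} AP) (X : Finset V) {n : ℕ}
    (hn : X.card + K.size ≤ n) : Nat.card (Letter K X) ≤ tower 5 n := by
  have hX : X.card ≤ tower 0 n := by simp only [tower]; omega
  have hW : K.weights.card ≤ tower 0 n := by simp only [Kripke.size, tower] at hn ⊢; omega
  have hAP : Nat.card AP ≤ tower 0 n := by simp only [Kripke.size, tower] at hn ⊢; omega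
  rw [Nat.card_fun, Nat.card_prod, Nat.card_eq_fintype_card (α := X), Fintype.card_coe,
    Nat.card_eq_fintype_card (α := K.weights), Fintype.card_coe]
  exact pow_le_tower (hW.trans (tower_mono_left (by omega) n)) (mul_le_tower hX hAP)

theorem QFFormula.recognizable_tower (K : Kripke.{u, v} AP) (φ : QFFormula F AP V) {n : ℕ}
    (h2 : 2 ≤ n) (hn : φ.size + K.size ≤ n) :
    Recognizable (tower 10 n) fun u => φ.value (wordAssignment K u) := by
  have h₁ : 2 ≤ tower 1 n := h2.trans (tower_le_succ 0 n)
  have h₂ : 4 ≤ tower 1 n := Nat.pow_le_pow_right (n := 2) (by norm_num) h2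
  have hW : K.weights.card ≤ tower 1 n := by
    refine le_trans ?_ (tower_le_succ 0 n)
    simp only [Kripke.size, tower] at hn ⊢
    omega
  have hφ : φ.size ≤ tower 1 n := by
    refine le_trans ?_ (tower_le_succ 0 n)
    simp only [tower]
    omega
  refine (φ.recognizable K h₁ hW).mono ?_
  have h₃ : tower 1 n ^ 4 ^ φ.size ≤ tower 7 n :=
    pow_le_tower (tower_mono_left (by omega) n) (pow_le_tower h₂ hφ)
  exact pow_le_tower h₃ h₃

theorem Formula.one_le_size (ψ : Formula F AP V) : 1 ≤ ψ.size := by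
  cases ψ with
  | qf φ => exact φ.one_le_size
  | all π ψ => simp only [size]; omega
  | ex π ψ => simp only [size]; omega

variable [DecidableEq V]

theorem BlockRecognizable.recognizable_tower {K : Kripke.{u, v} AP} {op : Set I → I} {h n : ℕ}
    {ψ : Formula F AP V} (hψ : BlockRecognizable K op (tower h n) ψ) (hh : 7 ≤ h)
    (hn : ψ.size + K.size ≤ n) :
    Recognizable (tower (h + 3) n) fun u => ψ.value K.traces (wordAssignment K u) :=
  hψ.recognizable.mono (Nat.pow_le_pow_right (by norm_num)
    (mul_le_tower le_rfl ((card_assigned_le_tower K hn).trans (tower_mono_left hh n))))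

/-- Each alternation of quantifiers adds a bounded number of exponentials. The outermost block is
kept apart, as it may be extended by further quantifiers of the same kind. -/
theorem Formula.blockRecognizable_tower (K : Kripke.{u, v} AP) {n : ℕ} (h2 : 2 ≤ n)
    (ψ : Formula F AP V) (hn : ψ.size + K.size ≤ n) :
    match ψ with
    | .qf φ => Recognizable (tower 10 n) fun u => φ.value (wordAssignment K u)
    | .ex π χ => BlockRecognizable K sSup (tower (3 * (ex π χ).alternations + 10) n) (ex π χ)
    | .all π χ => BlockRecognizable K sInf (tower (3 * (all π χ).alternations + 10) n)
        (all π χ) := by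
  induction ψ with
  | qf φ => exact φ.recognizable_tower K h2 hn
  | ex π χ ih =>
    have hn' : χ.size + K.size ≤ n := by simp only [size] at hn; omega
    specialize ih hn'
    refine BlockRecognizable.ex π ?_
    cases χ with
    | qf φ => exact blockRecognizable_of_recognizable (fun r => sSup_singleton) ih
    | ex π' χ => exact ih
    | all π' χ =>
      refine blockRecognizable_of_recognizable (fun r => sSup_singleton) ?_
      have := BlockRecognizable.recognizable_tower ih (by omega) hn'
      rw [alternations]
      convert this using 2
      ring
  | all π χ ih =>
    have hn' : χ.size + K.size ≤ n := by simp only [size] at hn; omega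
    specialize ih hn'
    refine BlockRecognizable.all π ?_
    cases χ with
    | qf φ => exact blockRecognizable_of_recognizable (fun r => sInf_singleton) ih
    | all π' χ => exact ih
    | ex π' χ =>
      refine blockRecognizable_of_recognizable (fun r => sInf_singleton) ?_
      have := BlockRecognizable.recognizable_tower ih (by omega) hn'
      rw [alternations]
      convert this using 2
      ring

theorem Formula.recognizable_tower (K : Kripke.{u, v} AP) {n : ℕ} (h2 : 2 ≤ n)
    (ψ : Formula F AP V) (hn : ψ.size + K.size ≤ n) :
    Recognizable (tower (3 * ψ.alternations + 13) n)
      fun u => ψ.value K.traces (wordAssignment K u) := by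
  have := ψ.blockRecognizable_tower K h2 hn
  cases ψ with
  | qf φ => exact Recognizable.mono this (tower_mono_left (by omega) n)
  | ex π χ => exact BlockRecognizable.recognizable_tower this (by omega) hn
  | all π χ => exact BlockRecognizable.recognizable_tower this (by omega) hn

theorem QFFormula.card_freeVars_le (φ : QFFormula F AP V) : φ.freeVars.card ≤ φ.size := by
  induction φ with
  | tt => simp [freeVars]
  | ff => simp [freeVars]
  | atom p π => simp [freeVars, size]
  | app f φ ih =>
    refine Finset.card_biUnion_le.trans ?_
    have := Finset.sum_le_sum fun i (_ : i ∈ Finset.univ) => ih i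
    rw [size]
    omega
  | next φ ih => simp only [freeVars, size]; omega
  | untl φ₁ φ₂ ih₁ ih₂ =>
    have := Finset.card_union_le φ₁.freeVars φ₂.freeVars
    simp only [freeVars, size]
    omega

theorem Formula.card_freeVars_le (ψ : Formula F AP V) : ψ.freeVars.card ≤ ψ.size := by
  induction ψ with
  | all π ψ ih =>
    have := Finset.card_erase_le (s := ψ.freeVars) (a := π)
    simp only [freeVars, size]
    omega
  | ex π ψ ih =>
    have := Finset.card_erase_le (s := ψ.freeVars) (a := π)
    simp only [freeVars, size]
    omega
  | qf φ => exact φ.card_freeVars_le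

/-- Extends a valuation of the variables in `X` to all variables, by a fixed valuation `d`. -/
def extendLetter (K : Kripke.{u, v} AP) {X : Finset V} (d : AP → K.weights) (a : Letter K X) :
    V → AP → K.weights :=
  fun π p => if h : π ∈ X then a (⟨π, h⟩, p) else d p

/-- The encodings of the assignments of traces to the free variables under which the value of the
formula lies in `P`, in terms of words over the alphabet of all variables. -/
theorem setOf_encode_eq (K : Kripke.{u, v} AP) (ψ : Formula F AP V) (P : Set I)
    (d : AP → K.weights) :
    {t | ∃ ρ : ψ.freeVars → K.traces,
        ψ.value K.traces (extendAssignment fun π => (ρ π).1) ∈ P ∧ t = encode K ρ} =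
      {t : ℕ → Letter K ψ.freeVars |
        (∀ π : ψ.freeVars, (fun k => extendLetter K d (t k) π) ∈ K.wordTraces) ∧
          ψ.value K.traces (wordAssignment K fun k => extendLetter K d (t k)) ∈ P} := by
  have hletter : ∀ (t : ℕ → Letter K ψ.freeVars) (π : ψ.freeVars) k p,
      extendLetter K (X := ψ.freeVars) d (t k) π p = t k (π, p) := fun t π k p => by
    simp [extendLetter]
  have hvalue : ∀ ρ : ψ.freeVars → K.traces,
      ψ.value K.traces (extendAssignment fun π => (ρ π).1) =
        ψ.value K.traces (wordAssignment K fun k => extendLetter K d (encode K ρ k)) := by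
    intro ρ
    refine ψ.value_congr _ fun π hπ => ?_
    funext k p
    simp only [wordAssignment, hletter _ ⟨π, hπ⟩, encode, extendAssignment, hπ, dif_pos]
  ext t
  constructor
  · rintro ⟨ρ, hρ, rfl⟩
    refine ⟨fun π => ?_, ?_⟩
    · have := K.mem_wordTraces_of_mem_traces (ρ π).2
      convert this using 3 with k p
      exact hletter _ π k p
    · rwa [← hvalue]
  · rintro ⟨h₁, h₂⟩
    have hmem : ∀ π : ψ.freeVars, (fun k p => (t k (π, p) : I)) ∈ K.traces := fun π => by
      have := K.mem_traces_of_mem_wordTraces (h₁ π)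
      simpa only [hletter] using this
    have ht : t = encode K fun π => ⟨_, hmem π⟩ := by
      funext k a
      rfl
    refine ⟨fun π => ⟨_, hmem π⟩, ?_, ht⟩
    rwa [hvalue, ← ht]

end Formulas

end HyperLTLProp

open HyperLTLProp

theorem mainTheorem2 :
    ∃ a b : ℕ, ∀ (F : HyperLTLProp.Functions.{w}) (AP : Type u) [Finite AP]
      (V : Type x) [DecidableEq V] (ψ : HyperLTLProp.Formula F AP V)
      (P : Set unitInterval) (K : HyperLTLProp.Kripke.{u, v} AP), K.traces.Nonempty →
      ∃ A : HyperLTLProp.NBA (HyperLTLProp.Letter K ψ.freeVars),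
        A.language =
          {t | ∃ ρ : ψ.freeVars → K.traces,
            ψ.value K.traces (HyperLTLProp.extendAssignment fun π => (ρ π).1) ∈ P ∧
              t = HyperLTLProp.encode K ρ} ∧
        A.size ≤ HyperLTLProp.tower (a * ψ.alternations + b) (ψ.size + K.size) := by
  -- Each alternation costs `3` levels by `Formula.recognizable_tower`. The constant is `13` for
  -- that lemma, `2` for the product with the constraint on the free variables, and `11` for the
  -- count of states and transitions of the Büchi automaton.
  refine ⟨3, 26, fun F AP _ V _ ψ P K hK => ?_⟩
  obtain ⟨-, s, -, -⟩ := hK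
  have := K.finiteState
  have : Nonempty K.State := ⟨s 0⟩
  have hS : 1 ≤ Nat.card K.State := Nat.card_pos
  have h2 : 2 ≤ ψ.size + K.size := by
    have := ψ.one_le_size
    simp only [Kripke.size]
    omega
  set n := ψ.size + K.size with hn
  set h := 3 * ψ.alternations + 15 with hh
  -- The letters at the variables that are not free in `ψ` are irrelevant. Any label of `K` will do,
  -- whereas `K.weights` alone need not provide one.
  let d : AP → K.weights := K.label (s 0)
  have htraces : Recognizable (tower 7 n) fun (t : ℕ → Letter K ψ.freeVars) (π : ψ.freeVars) =>
      (fun k => extendLetter K d (t k) π) ∈ K.wordTraces := by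
    refine (Recognizable.pi fun π : ψ.freeVars =>
      K.recognizable_mem_wordTraces.comap fun a : Letter K ψ.freeVars =>
        extendLetter K d a π).mono ?_
    rw [Nat.card_eq_fintype_card (α := ψ.freeVars), Fintype.card_coe]
    exact card_assigned_le_tower K (Nat.add_le_add_right ψ.card_freeVars_le _)
  have hvalue := (ψ.recognizable_tower K h2 le_rfl).comap (extendLetter K (X := ψ.freeVars) d)
  have hrec := ((htraces.prodMk hvalue).map fun y => (∀ π, y.1 π) ∧ y.2 ∈ P).mono
    (mul_le_tower (tower_mono_left (by omega) n) le_rfl)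
  obtain ⟨A, hA, hsize⟩ := hrec.exists_nba
  refine ⟨A, ?_, hsize.trans ?_⟩
  · rw [hA, setOf_encode_eq K ψ P d]
  · change tower h n * (tower h n * (tower h n * 2)) + tower h n * (tower h n * (tower h n * 2)) *
      (Nat.card (Letter K ψ.freeVars) * (tower h n * (tower h n * (tower h n * 2)))) ≤
        tower (h + 11) n
    have e : ∀ {i j}, i ≤ j → tower i n ≤ tower j n := fun hij => tower_mono_left hij n
    have h₁ : tower h n * 2 ≤ tower (h + 2) n :=
      mul_le_tower le_rfl (h2.trans (e (Nat.zero_le h)))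
    have h₂ : tower h n * (tower h n * 2) ≤ tower (h + 4) n :=
      mul_le_tower (e (by omega)) h₁
    have h₃ : tower h n * (tower h n * (tower h n * 2)) ≤ tower (h + 6) n :=
      mul_le_tower (e (by omega)) h₂
    have h₄ := (card_letter_le_tower K ψ.freeVars
      (Nat.add_le_add_right ψ.card_freeVars_le _)).trans (e (show 5 ≤ h + 6 by omega))
    exact add_le_tower (h₃.trans (e (by omega)))
      (mul_le_tower (h₃.trans (e (by omega))) (mul_le_tower h₄ h₃))
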